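/- Let $k\ge 1$ and $N$ be positive integers, and let $v_1,\dots,v_N\in\mathbb{R}^2$ be nonzero vectors such that $\{v_i,v_j\}$ is a basis of $\mathbb{R}^2$ whenever $i\ne j$. For $v=(v^1,v^2)\in\mathbb{R}^2$ and $x=(x^1,x^2)\in\mathbb{R}^k\times\mathbb{R}^k=\mathbb{R}^{2k}$ write $v\cdot x=v^1x^1+v^2x^2\in\mathbb{R}^k$, and for functions $f_1,\dots,f_N$ on $\mathbb{R}^k$ put $$\Lambda(f_1,\dots,f_N)=\int_{\mathbb{R}^{2k}}\prod_{j=1}^N f_j(v_j\cdot x)\,dx .$$ For $1<p<\infty$ and $\lambda\in\mathbb{R}$ let $\|f\|_{L^p_\lambda}=\big\|\,|\cdot|^\lambda f\,\big\|_{L^p(\mathbb{R}^k)}$, and let $L^p_\lambda$ be the space of measurable $f$ with $\|f\|_{L^p_\lambda}<\infty$. Suppose that $1/p_j\in(0,1)$ and $\lambda_j\in\mathbb{R}$ for $j=1,\dots,N$, and that $$\sum_{j=1}^N\Big(\frac1{p_j}+\frac{\lambda_j}{k}\Big)=2,\qquad \sum_{j\ne\ell}\Big(\frac1{p_j}+\frac{\lambda_j}{k}\Big)>1\quad\text{and}\quad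 \sum_{j\neq\ell}\lambda_j\ge 0\quad(\ell=1,\dots,N),\qquad \sum_{j=1}^N\frac1{p_j}\ge 1 .$$ Then there is a finite constant $C$, independent of the functions $f_j$, such that $$|\Lambda(f_1,\dots,f_N)|\le C\prod_{j=1}^N\|f_j\|_{L^{p_j}_{\lambda_j}}$$ for all measurable $f_j:\mathbb{R}^k\to[0,\infty]$ (as an inequality in $[0,\infty]$, with $0\cdot\infty=0$), and for all real or complex valued $f_j\in L^{p_j}_{\lambda_j}$, in which case the integral defining $\Lambda(f_1,\dots,f_N)$ converges absolutely. -/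

import Mathlib

open MeasureTheory
open scoped ENNReal NNReal

noncomputable section

/-- The space `ℝᵏ` with its Euclidean norm and Lebesgue measure. A point of `ℝ²ᵏ` is written
`x = (x.1, x.2) : Rk k × Rk k`; the volume on this product is Lebesgue measure on `ℝ²ᵏ`. -/
abbrev Rk (k : ℕ) : Type := EuclideanSpace ℝ (Fin k)

/-- `v · x = v¹ x¹ + v² x²` for `v = (v¹, v²) ∈ ℝ²` and `x = (x¹, x²) ∈ ℝ²ᵏ`. -/
def pairing {k : ℕ} (v : Fin 2 → ℝ) (x : Rk k × Rk k) : Rk k :=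
  v 0 • x.1 + v 1 • x.2

/-- The norm `‖f‖_{L^p_a} = ‖ |·|^a f ‖_{L^p(ℝᵏ)}`, with values in `[0, ∞]`. It is used for
scalar functions and for functions with values in `[0, ∞]`. -/
def weightedNorm {k : ℕ} {F : Type*} [ENorm F] (p : ℝ) (a : ℝ) (f : Rk k → F) : ℝ≥0∞ :=
  eLpNorm (fun y : Rk k => ‖y‖ₑ ^ a * ‖f y‖ₑ) (ENNReal.ofReal p) volume

/-- Membership in `L^p_a`: `f` is measurable (up to a null set) and `‖f‖_{L^p_a} < ∞`. -/
def MemWeightedLp {k : ℕ} {F : Type*} [NormedAddCommGroup F] (p : ℝ) (a : ℝ)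
    (f : Rk k → F) : Prop :=
  AEStronglyMeasurable f volume ∧ weightedNorm p a f < ∞

/-- The integrand `f₁(v₁ · x) ⋯ f_N(v_N · x)` of the multilinear form. -/
def formIntegrand {k N : ℕ} {R : Type*} [CommMonoid R] (v : Fin N → Fin 2 → ℝ)
    (f : Fin N → Rk k → R) (x : Rk k × Rk k) : R :=
  ∏ j, f j (pairing (v j) x)

/-- The form `Λ(f₁, …, f_N)` for functions with values in `[0, ∞]`: always defined,
with values in `[0, ∞]`. -/
def formNonneg {k N : ℕ} (v : Fin N → Fin 2 → ℝ) (f : Fin N → Rk k → ℝ≥0∞) : ℝ≥0∞ :=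
  ∫⁻ x, formIntegrand v f x

/-- The form `Λ(f₁, …, f_N)` for real or complex valued functions. -/
def form {k N : ℕ} {𝕜 : Type*} [RCLike 𝕜] (v : Fin N → Fin 2 → ℝ)
    (f : Fin N → Rk k → 𝕜) : 𝕜 :=
  ∫ x, formIntegrand v f x

end

/-! Put θ_j = 1/p_j and L = ∑ λ_j. For f_j of norm 1 let G_j = (|y|^{λ_j} f_j)^{p_j}, so that ∫ G_j
= 1 and f_j = G_j^{θ_j} |y|^{-λ_j} off the origin. Scaling now reads ∑ θ_j = 2 - L/k, the strict
conditions read θ_l + λ_l/k < 1, the index conditions read λ_l ≤ L (whence L ≥ 0), and the last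
hypothesis reads L ≤ k.

Up to a null set, ℝ²ᵏ is covered by the N regions where some |v_l·x| is smallest. On such a region
every other |v_j·x| is comparable to |x|, so the product of the weights is at most a constant times
|v_l·x|^{-λ_l} |x|^{λ_l-L} (`exists_prod_weight_le`).

If λ_l < L, put s = L/k. Hölder with weights s and 1 - s splits the integral in two
(`exists_lintegral_regionKernel_le`). One factor is an unweighted form with exponents in [0,1] of
sum 2; it is interpolated between the products ∫∫ G_i G_j (`exists_lintegral_prod_rpow_le`). The
other has a kernel homogeneous of degree -k and exponents of sum 1; Hölder reduces it to forms with
a single G_j, where the kernel can be integrated out in the other variable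
(`exists_lintegral_regionKernel_simplex_le`).

If λ_l = L, the kernel |v_l·x|^{-L} is the endpoint of that range. Then h = G_l^{θ_l} |y|^{-L} is
only a weak-type kernel, and a Hardy–Littlewood–Sobolev inequality
(`exists_lintegral_weakKernel_le`) treats it against two of the remaining functions; interpolation
spreads the exponents over all of them (`exists_lintegral_singleWeight_le`). -/

/-! ### Integrals of powers of the norm -/

theorem lintegral_ofReal_comp_norm {k : ℕ} (hk : 1 ≤ k) (f : ℝ → ℝ) (hf0 : ∀ r, 0 ≤ f r)
    (hf : IntegrableOn (fun r => r ^ (k - 1) • f r) (Set.Ioi (0 : ℝ))) :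
    ∫⁻ y : Rk k, ENNReal.ofReal (f ‖y‖)
      = ENNReal.ofReal (k • (volume : Measure (Rk k)).real (Metric.ball 0 1) •
          ∫ r in Set.Ioi (0 : ℝ), r ^ (k - 1) • f r) := by
  have : Nonempty (Fin k) := ⟨⟨0, hk⟩⟩
  have hd : Module.finrank ℝ (Rk k) = k := by simp
  have h1 := integral_fun_norm_addHaar (volume : Measure (Rk k)) f
  have h2 := (integrable_fun_norm_addHaar (volume : Measure (Rk k)) (f := f))
  rw [hd] at h1 h2
  rw [← h1, ofReal_integral_eq_lintegral_ofReal (h2.2 hf) (ae_of_all _ fun y => hf0 _)]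

theorem enorm_rpow_eq_ofReal {E : Type*} [NormedAddCommGroup E] {y : E} (hy : y ≠ 0) (s : ℝ) :
    ‖y‖ₑ ^ s = ENNReal.ofReal (‖y‖ ^ s) := by
  rw [← ofReal_norm, ENNReal.ofReal_rpow_of_pos (norm_pos_iff.2 hy)]

theorem ae_ne_zero {k : ℕ} (hk : 1 ≤ k) : ∀ᵐ y : Rk k, y ≠ 0 := by
  have : Nonempty (Fin k) := ⟨⟨0, hk⟩⟩
  exact Measure.ae_ne volume 0

/-- The integral of `|y|^(-γ)` over a ball of radius `R`, for `γ < k`. -/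
theorem exists_lintegral_closedBall_rpow_le {k : ℕ} (hk : 1 ≤ k) {γ : ℝ} (hγ : γ < k) :
    ∃ C : ℝ≥0, ∀ R : ℝ, 0 < R →
      ∫⁻ y in Metric.closedBall (0 : Rk k) R, ‖y‖ₑ ^ (-γ) ≤ C * ENNReal.ofReal R ^ (k - γ) := by
  refine ⟨(k • (volume : Measure (Rk k)).real (Metric.ball 0 1) * (k - γ)⁻¹).toNNReal,
    fun R hR => ?_⟩
  set f : ℝ → ℝ := (Set.Ioc 0 R).indicator fun r => r ^ (-γ) with hf
  have hf0 : ∀ r, 0 ≤ f r := fun r => Set.indicator_nonneg (fun r hr => Real.rpow_nonneg hr.1.le _) r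
  have hfe : (fun r : ℝ => r ^ (k - 1) • f r)
      = (Set.Ioc 0 R).indicator fun r => r ^ ((k : ℝ) - 1 - γ) := by
    funext r
    by_cases hr : r ∈ Set.Ioc 0 R
    · simp only [hf, Set.indicator_of_mem hr, smul_eq_mul]
      rw [← Real.rpow_natCast, ← Real.rpow_add hr.1]
      push_cast [hk]; ring_nf
    · simp [hf, Set.indicator_of_notMem hr]
  have hint : IntegrableOn (fun r : ℝ => r ^ ((k : ℝ) - 1 - γ)) (Set.Ioc 0 R) := by
    rw [← intervalIntegrable_iff_integrableOn_Ioc_of_le hR.le]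
    exact intervalIntegral.intervalIntegrable_rpow' (by linarith)
  have hval : ∫ r in Set.Ioi (0 : ℝ), r ^ (k - 1) • f r = R ^ (k - γ) * (k - γ)⁻¹ := by
    rw [hfe, setIntegral_indicator measurableSet_Ioc, Set.inter_eq_right.2 Set.Ioc_subset_Ioi_self,
      ← intervalIntegral.integral_of_le hR.le, integral_rpow (Or.inl (by linarith))]
    have : (k : ℝ) - 1 - γ + 1 = k - γ := by ring
    rw [this, Real.zero_rpow (by linarith), sub_zero, div_eq_mul_inv]
  have key := lintegral_ofReal_comp_norm hk f hf0 (by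
    rw [hfe]; exact (hint.integrable_indicator measurableSet_Ioc).integrableOn)
  calc ∫⁻ y in Metric.closedBall (0 : Rk k) R, ‖y‖ₑ ^ (-γ)
      ≤ ∫⁻ y : Rk k, ENNReal.ofReal (f ‖y‖) := by
        rw [← lintegral_indicator Metric.isClosed_closedBall.measurableSet]
        refine lintegral_mono_ae ?_
        filter_upwards [ae_ne_zero hk] with y hy
        by_cases hyR : ‖y‖ ≤ R
        · rw [Set.indicator_of_mem (by simpa using hyR), hf,
            Set.indicator_of_mem (Set.mem_Ioc.2 ⟨norm_pos_iff.2 hy, hyR⟩),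
            enorm_rpow_eq_ofReal hy]
        · rw [Set.indicator_of_notMem (by simpa using hyR)]; exact zero_le
    _ = _ := by
        rw [key, hval, ENNReal.ofReal_rpow_of_pos hR, ← ENNReal.ofReal_coe_nnreal,
          ← ENNReal.ofReal_mul (NNReal.coe_nonneg _), Real.coe_toNNReal _ (by
            have : 0 < (k : ℝ) - γ := by linarith
            positivity)]
        congr 1
        simp only [nsmul_eq_mul, smul_eq_mul]; ring

/-- The integral of `|y|^(γ-k)` outside a ball of radius `R`, for `γ < 0`. -/
theorem exists_lintegral_compl_ball_rpow_le {k : ℕ} (hk : 1 ≤ k) {γ : ℝ} (hγ : γ < 0) :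
    ∃ C : ℝ≥0, ∀ R : ℝ, 0 < R →
      ∫⁻ y in {y : Rk k | R ≤ ‖y‖}, ‖y‖ₑ ^ (γ - k) ≤ C * ENNReal.ofReal R ^ γ := by
  refine ⟨(k • (volume : Measure (Rk k)).real (Metric.ball 0 1) * (-γ)⁻¹).toNNReal,
    fun R hR => ?_⟩
  set f : ℝ → ℝ := (Set.Ici R).indicator fun r => r ^ (γ - k) with hf
  have hf0 : ∀ r, 0 ≤ f r := fun r =>
    Set.indicator_nonneg (fun r hr => Real.rpow_nonneg (hR.le.trans hr) _) r
  have hfe : (fun r : ℝ => r ^ (k - 1) • f r)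
      = (Set.Ici R).indicator fun r => r ^ (γ - 1) := by
    funext r
    by_cases hr : r ∈ Set.Ici R
    · simp only [hf, Set.indicator_of_mem hr, smul_eq_mul]
      rw [← Real.rpow_natCast, ← Real.rpow_add (hR.trans_le hr)]
      push_cast [hk]; ring_nf
    · simp [hf, Set.indicator_of_notMem hr]
  have hint : IntegrableOn (fun r : ℝ => r ^ (γ - 1)) (Set.Ici R) := by
    rw [integrableOn_Ici_iff_integrableOn_Ioi]
    exact integrableOn_Ioi_rpow_of_lt (by linarith) hR
  have hval : ∫ r in Set.Ioi (0 : ℝ), r ^ (k - 1) • f r = R ^ γ * (-γ)⁻¹ := by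
    rw [hfe, setIntegral_indicator measurableSet_Ici,
      Set.inter_eq_right.2 (Set.Ici_subset_Ioi.2 hR), integral_Ici_eq_integral_Ioi,
      integral_Ioi_rpow_of_lt (by linarith) hR]
    have : γ - 1 + 1 = γ := by ring
    rw [this, inv_neg, div_eq_mul_inv]; ring
  have key := lintegral_ofReal_comp_norm hk f hf0 (by
    rw [hfe]; exact (hint.integrable_indicator measurableSet_Ici).integrableOn)
  calc ∫⁻ y in {y : Rk k | R ≤ ‖y‖}, ‖y‖ₑ ^ (γ - k)
      ≤ ∫⁻ y : Rk k, ENNReal.ofReal (f ‖y‖) := by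
        have hm : MeasurableSet {y : Rk k | R ≤ ‖y‖} := measurableSet_le measurable_const measurable_norm
        rw [← lintegral_indicator hm]
        refine lintegral_mono fun y => ?_
        by_cases hy : R ≤ ‖y‖
        · rw [Set.indicator_of_mem (by exact hy), hf, Set.indicator_of_mem (by exact hy),
            enorm_rpow_eq_ofReal (norm_pos_iff.1 (hR.trans_le hy))]
        · rw [Set.indicator_of_notMem (by exact hy)]; exact zero_le
    _ = _ := by
        rw [key, hval, ENNReal.ofReal_rpow_of_pos hR, ← ENNReal.ofReal_coe_nnreal,
          ← ENNReal.ofReal_mul (NNReal.coe_nonneg _), Real.coe_toNNReal _ (by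
            have : 0 < -γ := by linarith
            positivity)]
        congr 1
        simp only [nsmul_eq_mul, smul_eq_mul]; ring

/-! ### Polytopes of exponents -/

/-- A convex set that contains the points `α e_i + (S - α) e_j` with distinct `i, j ∈ J` contains
the polytope of all `σ` supported in `J` with `0 ≤ σ ≤ α` and `∑ σ = S`. -/
theorem mem_of_convex_of_vertices {ι : Type*} [Fintype ι] [DecidableEq ι] {s : Set (ι → ℝ)}
    (hs : Convex ℝ s) {J : Finset ι} (hJ : 2 ≤ J.card) {α S : ℝ} (hα : 0 < α) (h1 : α ≤ S) (h2 : S ≤ 2 * α)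
    (hv : ∀ i ∈ J, ∀ j ∈ J, i ≠ j → Pi.single i α + Pi.single j (S - α) ∈ s)
    (σ : ι → ℝ) (h0 : ∀ j, 0 ≤ σ j) (hle : ∀ j, σ j ≤ α) (hsupp : ∀ j, j ∉ J → σ j = 0)
    (hsum : ∑ j, σ j = S) : σ ∈ s := by
  -- Induction on the number of coordinates strictly between 0 and α. With two of them, σ lies
  -- inside a segment whose ends have fewer; with at most one, σ is itself a vertex.
  induction hn : (Finset.univ.filter fun j => 0 < σ j ∧ σ j < α).card using Nat.strong_induction_on
    generalizing σ with
  | _ n ih =>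
  by_cases htwo : ∃ i j, i ≠ j ∧ (0 < σ i ∧ σ i < α) ∧ (0 < σ j ∧ σ j < α)
  · obtain ⟨i, j, hij, hi, hj⟩ := htwo
    have hiJ : i ∈ J := by by_contra h; exact hi.1.ne' (hsupp i h)
    have hjJ : j ∈ J := by by_contra h; exact hj.1.ne' (hsupp j h)
    -- moving mass from `j` to `i` until one of the two coordinates leaves `(0, α)`
    have move : ∀ i j, i ≠ j → i ∈ J → j ∈ J → (0 < σ i ∧ σ i < α) → (0 < σ j ∧ σ j < α) →
        σ + (Pi.single i (min (α - σ i) (σ j)) - Pi.single j (min (α - σ i) (σ j))) ∈ s := by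
      intro i j hij hiJ hjJ hi hj
      set t := min (α - σ i) (σ j) with ht
      have ht1 : t ≤ α - σ i := min_le_left _ _
      have ht2 : t ≤ σ j := min_le_right _ _
      have ht0 : 0 < t := lt_min (by linarith [hi.2]) hj.1
      have ev : ∀ m, (σ + (Pi.single i t - Pi.single j t) : ι → ℝ) m
          = if m = i then σ i + t else if m = j then σ j - t else σ m := by
        intro m
        by_cases hmi : m = i
        · subst hmi; simp [hij]
        · by_cases hmj : m = j
          · subst hmj; simp [hmi, sub_eq_add_neg]
          · simp [hmi, hmj]
      refine ih _ ?_ _ ?_ ?_ ?_ ?_ rfl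
      · rw [← hn]
        apply Finset.card_lt_card
        rw [Finset.ssubset_iff_of_subset]
        · rcases min_choice (α - σ i) (σ j) with h | h
          · refine ⟨i, by simp [hi], ?_⟩
            simp only [Finset.mem_filter, Finset.mem_univ, true_and, ev]
            simp [ht, h]
          · refine ⟨j, by simp [hj], ?_⟩
            simp only [Finset.mem_filter, Finset.mem_univ, true_and, ev]
            simp [ht, h, hij.symm]
        · intro m
          simp only [Finset.mem_filter, Finset.mem_univ, true_and, ev]
          split_ifs with hmi hmj
          · subst hmi; exact fun _ => hi
          · subst hmj; exact fun _ => hj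
          · exact id
      · intro m; rw [ev]; split_ifs
        · linarith [h0 i]
        · linarith
        · exact h0 m
      · intro m; rw [ev]; split_ifs
        · linarith
        · linarith [hle j]
        · exact hle m
      · intro m hm; rw [ev, if_neg (by rintro rfl; exact hm hiJ), if_neg (by rintro rfl; exact hm hjJ)]
        exact hsupp m hm
      · simp [Finset.sum_add_distrib, hsum]
    have m1 := move i j hij hiJ hjJ hi hj
    have m2 := move j i hij.symm hjJ hiJ hj hi
    set t := min (α - σ i) (σ j)
    set u := min (α - σ j) (σ i)
    have ht0 : 0 < t := lt_min (by linarith [hi.2]) hj.1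
    have hu0 : 0 < u := lt_min (by linarith [hj.2]) hi.1
    -- The two points are displaced from σ by t and by -u along e_i - e_j, so these weights cancel
    -- the displacements.
    have := hs m1 m2 (a := u / (t + u)) (b := t / (t + u)) (by positivity) (by positivity)
      (by field_simp; ring)
    convert this using 1
    funext m
    simp only [Pi.add_apply, Pi.smul_apply, Pi.sub_apply, smul_eq_mul]
    have e1 : (Pi.single i t : ι → ℝ) m = t * (Pi.single i 1 : ι → ℝ) m := by
      simp [Pi.single_apply]
    have e2 : (Pi.single j t : ι → ℝ) m = t * (Pi.single j 1 : ι → ℝ) m := by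
      simp [Pi.single_apply]
    have e3 : (Pi.single i u : ι → ℝ) m = u * (Pi.single i 1 : ι → ℝ) m := by
      simp [Pi.single_apply]
    have e4 : (Pi.single j u : ι → ℝ) m = u * (Pi.single j 1 : ι → ℝ) m := by
      simp [Pi.single_apply]
    rw [e1, e2, e3, e4]
    field_simp
    ring
  · push Not at htwo
    have huniq : ∀ i j, i ≠ j → (0 < σ i ∧ σ i < α) → σ j = 0 ∨ σ j = α := by
      intro i j hij hi
      rcases (h0 j).eq_or_lt with h | h
      · exact Or.inl h.symm
      · exact Or.inr (le_antisymm (hle j) (htwo i j hij hi h))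
    -- Otherwise at most one coordinate is nonzero, and the sum is below α ≤ S.
    have hex : ∃ i, σ i = α := by
      by_contra! hne
      have hlt : ∀ i, σ i < α := fun i => lt_of_le_of_ne (hle i) (hne i)
      by_cases hpos : ∃ i, 0 < σ i
      · obtain ⟨i, hi⟩ := hpos
        have : ∑ j, σ j = σ i := Finset.sum_eq_single i
          (fun j _ hj => (huniq i j hj.symm ⟨hi, hlt i⟩).resolve_right (hne j)) (by simp)
        linarith [hlt i]
      · push Not at hpos
        have : ∑ j, σ j ≤ 0 := Finset.sum_nonpos fun j _ => hpos j
        linarith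
    obtain ⟨i, hi⟩ := hex
    have hiJ : i ∈ J := by by_contra h; linarith [hsupp i h]
    have hrest : ∑ j ∈ Finset.univ.erase i, σ j = S - α := by
      rw [← hsum, ← Finset.add_sum_erase _ _ (Finset.mem_univ i), hi]; ring
    have hfin : ∃ j ∈ J, i ≠ j ∧ ∀ m, m ≠ i → m ≠ j → σ m = 0 := by
      by_cases hpos : ∃ j, j ≠ i ∧ 0 < σ j
      · obtain ⟨j, hji, hj⟩ := hpos
        by_cases hbig : ∃ j, j ≠ i ∧ σ j = α
        · obtain ⟨j, hji, hj⟩ := hbig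
          refine ⟨j, by by_contra h; linarith [hsupp j h], hji.symm, fun m hmi hmj => ?_⟩
          have hjm : j ∈ Finset.univ.erase i := by simp [hji]
          have : ∑ m ∈ (Finset.univ.erase i).erase j, σ m = S - α - α := by
            rw [← hrest, ← Finset.add_sum_erase _ _ hjm, hj]; ring
          have hm : σ m ≤ ∑ m ∈ (Finset.univ.erase i).erase j, σ m :=
            Finset.single_le_sum (fun j _ => h0 j) (by simp [hmi, hmj])
          linarith [h0 m]
        · push Not at hbig
          refine ⟨j, by by_contra h; linarith [hsupp j h], hji.symm, fun m hmi hmj => ?_⟩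
          exact (huniq j m hmj.symm ⟨hj, lt_of_le_of_ne (hle j) (hbig j hji)⟩).resolve_right
            (hbig m hmi)
      · push Not at hpos
        -- Here S = α and the second vertex index carries no mass, so any other element of J serves.
        obtain ⟨j, hjJ, hji⟩ := Finset.exists_mem_ne (by omega : 1 < J.card) i
        exact ⟨j, hjJ, hji.symm, fun m hm _ => le_antisymm (hpos m hm) (h0 m)⟩
    obtain ⟨j, hjJ, hij, hz⟩ := hfin
    have hj : σ j = S - α := by
      rw [← hrest]
      symm
      apply Finset.sum_eq_single j
      · intro m hm hmj; exact hz m (Finset.ne_of_mem_erase hm) hmj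
      · intro h; simp [hij.symm] at h
    have : σ = Pi.single i α + Pi.single j (S - α) := by
      funext m
      by_cases hmi : m = i
      · subst hmi; simp [hi, hij]
      · by_cases hmj : m = j
        · subst hmj; simp [hj, hmi]
        · simp [hmi, hmj, hz m hmi hmj]
    rw [this]
    exact hv i hiJ j hjJ hij

theorem exists_sum_eq_between {ι : Type*} [Fintype ι] (a b : ι → ℝ) (c : ℝ) (hab : ∀ j, a j ≤ b j)
    (ha : ∑ j, a j ≤ c) (hb : c ≤ ∑ j, b j) :
    ∃ r : ι → ℝ, (∀ j, a j ≤ r j) ∧ (∀ j, r j ≤ b j) ∧ ∑ j, r j = c := by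
  have hcont : Continuous fun t : ℝ => ∑ j, (a j + t * (b j - a j)) := by fun_prop
  obtain ⟨t, ht, h⟩ := intermediate_value_Icc (zero_le_one (α := ℝ)) hcont.continuousOn
    (show c ∈ Set.Icc _ _ by simpa using ⟨ha, hb⟩)
  refine ⟨fun j => a j + t * (b j - a j), fun j => ?_, fun j => ?_, h⟩
  · nlinarith [hab j, ht.1]
  · nlinarith [hab j, ht.2]

/-! ### Linear coordinates given by pairs of the vectors -/

section Geometry

variable {k : ℕ}

theorem continuous_pairing (v : Fin 2 → ℝ) : Continuous (pairing v : Rk k × Rk k → Rk k) := by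
  unfold pairing; fun_prop

theorem measurable_pairing (v : Fin 2 → ℝ) : Measurable (pairing v : Rk k × Rk k → Rk k) :=
  (continuous_pairing v).measurable

theorem det_ne_zero_of_linearIndependent {v w : Fin 2 → ℝ} (h : LinearIndependent ℝ ![v, w]) :
    v 0 * w 1 - v 1 * w 0 ≠ 0 := by
  have h1 := (Matrix.linearIndependent_rows_iff_isUnit (A := Matrix.of ![v, w])).1 h
  rw [Matrix.isUnit_iff_isUnit_det, Matrix.det_fin_two] at h1
  simpa using h1.ne_zero

/-- Two independent vectors of `ℝ²` give linear coordinates `(v · x, w · x)` on `ℝ²ᵏ`. -/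
theorem exists_equiv_pairing {v w : Fin 2 → ℝ} (h : LinearIndependent ℝ ![v, w]) :
    ∃ e : (Rk k × Rk k) ≃L[ℝ] (Rk k × Rk k), ∀ x, e x = (pairing v x, pairing w x) := by
  have hd := det_ne_zero_of_linearIndependent h
  set d := v 0 * w 1 - v 1 * w 0 with hdd
  let e : (Rk k × Rk k) ≃ₗ[ℝ] (Rk k × Rk k) :=
    { toFun := fun x => (pairing v x, pairing w x)
      invFun := fun z => ((w 1 / d) • z.1 - (v 1 / d) • z.2, (v 0 / d) • z.2 - (w 0 / d) • z.1)
      map_add' := fun x y => by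
        ext i <;> simp [pairing] <;> ring
      map_smul' := fun c x => by
        ext i <;> simp [pairing] <;> ring
      left_inv := fun x => by
        ext i <;> simp [pairing] <;> field_simp <;> rw [hdd] <;> ring
      right_inv := fun x => by
        ext i <;> simp [pairing] <;> field_simp <;> rw [hdd] <;> ring }
  exact ⟨e.toContinuousLinearEquiv, fun x => rfl⟩

/-- A linear isomorphism carries Lebesgue measure to a Haar measure, which is a constant multiple of
Lebesgue measure. -/
theorem exists_lintegral_pairing_eq {v w : Fin 2 → ℝ} (h : LinearIndependent ℝ ![v, w]) :
    ∃ c : ℝ≥0, ∀ F : Rk k × Rk k → ℝ≥0∞, Measurable F →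
      ∫⁻ x, F (pairing v x, pairing w x) = c * ∫⁻ z, F z := by
  obtain ⟨e, he⟩ := exists_equiv_pairing (k := k) h
  have : (volume : Measure (Rk k × Rk k)).IsAddHaarMeasure := by
    rw [Measure.volume_eq_prod]; infer_instance
  have := e.isAddHaarMeasure_map (volume : Measure (Rk k × Rk k))
  obtain ⟨c, hmap⟩ : ∃ c : ℝ≥0, Measure.map e (volume : Measure (Rk k × Rk k)) = c • volume :=
    ⟨_, Measure.isAddLeftInvariant_eq_smul _ _⟩
  refine ⟨c, fun F hF => ?_⟩
  simp_rw [← he]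
  rw [← lintegral_map hF e.continuous.measurable, hmap, lintegral_smul_measure]
  rfl

/-- This lets functions known only up to null sets be composed with `pairing v`. The vector `w`
serves only to complete `v` to a coordinate system. -/
theorem quasiMeasurePreserving_pairing {v w : Fin 2 → ℝ} (h : LinearIndependent ℝ ![v, w]) :
    Measure.QuasiMeasurePreserving (pairing v : Rk k × Rk k → Rk k) volume volume := by
  obtain ⟨c, hc⟩ := exists_lintegral_pairing_eq (k := k) h
  refine ⟨measurable_pairing v, Measure.AbsolutelyContinuous.mk fun s hs h0 => ?_⟩
  rw [Measure.map_apply (measurable_pairing v) hs,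
    ← lintegral_indicator_one (measurable_pairing v hs)]
  have := hc (fun z => (Prod.fst ⁻¹' s).indicator 1 z)
    (measurable_one.indicator (measurable_fst hs))
  calc _ = ∫⁻ x, (Prod.fst ⁻¹' s).indicator 1 (pairing v x, pairing w x) := rfl
    _ = 0 := by
      rw [this, lintegral_indicator_one (measurable_fst hs), Measure.volume_eq_prod,
        ← Set.prod_univ, Measure.prod_prod, h0]
      simp

theorem exists_norm_pairing_le (v : Fin 2 → ℝ) :
    ∃ C : ℝ, 0 < C ∧ ∀ x : Rk k × Rk k, ‖pairing v x‖ ≤ C * ‖x‖ := by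
  refine ⟨|v 0| + |v 1| + 1, by positivity, fun x => ?_⟩
  calc ‖pairing v x‖ ≤ ‖v 0 • x.1‖ + ‖v 1 • x.2‖ := norm_add_le _ _
    _ = |v 0| * ‖x.1‖ + |v 1| * ‖x.2‖ := by simp [norm_smul]
    _ ≤ |v 0| * ‖x‖ + |v 1| * ‖x‖ := by gcongr <;> [exact norm_fst_le x; exact norm_snd_le x]
    _ ≤ _ := by nlinarith [norm_nonneg x]

theorem exists_norm_le_pairing {v w : Fin 2 → ℝ} (h : LinearIndependent ℝ ![v, w]) :
    ∃ C : ℝ, 0 < C ∧ ∀ x : Rk k × Rk k, ‖x‖ ≤ C * max ‖pairing v x‖ ‖pairing w x‖ := by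
  obtain ⟨e, he⟩ := exists_equiv_pairing (k := k) h
  refine ⟨‖(e.symm : (Rk k × Rk k) →L[ℝ] (Rk k × Rk k))‖ + 1, by positivity, fun x => ?_⟩
  have := (e.symm : (Rk k × Rk k) →L[ℝ] (Rk k × Rk k)).le_opNorm (e x)
  simp only [ContinuousLinearEquiv.coe_coe, e.symm_apply_apply] at this
  rw [he] at this
  refine this.trans ?_
  rw [Prod.norm_mk]
  gcongr
  linarith

/-- For pairwise independent `u, v, w`, the form `w · x` is a combination of `u · x` and `v · x`
in which `v · x` occurs. -/
theorem exists_pairing_eq_combination {u v w : Fin 2 → ℝ} (huv : LinearIndependent ℝ ![u, v])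
    (huw : LinearIndependent ℝ ![u, w]) :
    ∃ a b : ℝ, b ≠ 0 ∧ ∀ x : Rk k × Rk k, pairing w x = a • pairing u x + b • pairing v x := by
  have hd := det_ne_zero_of_linearIndependent huv
  have hd' := det_ne_zero_of_linearIndependent huw
  refine ⟨(w 0 * v 1 - w 1 * v 0) / (u 0 * v 1 - u 1 * v 0),
    (u 0 * w 1 - u 1 * w 0) / (u 0 * v 1 - u 1 * v 0), div_ne_zero hd' hd, fun x => ?_⟩
  ext i
  simp only [pairing, PiLp.add_apply, PiLp.smul_apply, smul_eq_mul]
  set d := u 0 * v 1 - u 1 * v 0 with hdd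
  field_simp
  rw [hdd]
  ring

theorem lintegral_comp_affine (G : Rk k → ℝ≥0∞) (hG : Measurable G) (z : Rk k) {b : ℝ}
    (hb : b ≠ 0) :
    ∫⁻ y, G (z + b • y) = ENNReal.ofReal |(b ^ k)⁻¹| * ∫⁻ y, G y := by
  have h1 := Measure.map_addHaar_smul (volume : Measure (Rk k)) hb
  have h2 : Module.finrank ℝ (Rk k) = k := by simp
  have hm : Measurable fun y => G (z + y) := hG.comp (measurable_const_add z)
  rw [← lintegral_map (f := fun y => G (z + y)) hm (measurable_const_smul b), h1, h2,
    lintegral_smul_measure, lintegral_add_left_eq_self]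
  rfl

end Geometry

/-! ### A Hardy–Littlewood–Sobolev inequality for weak-type kernels -/

section WeakKernel

variable {k : ℕ}

/-- Cut E at the radius R = |E|^{1/k}. The ball contributes a multiple of R^{k-s}, and outside it
the integrand is at most R^{-s}; both bounds scale as |E|^{1-s/k}. -/
theorem exists_setLIntegral_rpow_le (hk : 1 ≤ k) {s : ℝ} (hs0 : 0 ≤ s) (hs : s < k) :
    ∃ C : ℝ≥0, ∀ E : Set (Rk k), MeasurableSet E →
      ∫⁻ y in E, ‖y‖ₑ ^ (-s) ≤ C * volume E ^ (1 - s / k) := by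
  obtain ⟨C, hC⟩ := exists_lintegral_closedBall_rpow_le hk hs
  have hk0 : (0 : ℝ) < k := by exact_mod_cast hk
  have hpos : 0 < 1 - s / k := by rw [sub_pos, div_lt_one hk0]; exact hs
  refine ⟨C + 1, fun E hE => ?_⟩
  rcases eq_or_ne (volume E) 0 with h0 | h0
  · simp [Measure.restrict_eq_zero.2 h0]
  rcases eq_or_ne (volume E) ∞ with htop | htop
  · rw [htop, ENNReal.top_rpow_of_pos hpos, ENNReal.mul_top (by simp)]
    exact le_top
  set m := volume E
  set R : ℝ := m.toReal ^ (1 / (k : ℝ)) with hR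
  have hm0 : 0 < m.toReal := ENNReal.toReal_pos h0 htop
  have hR0 : 0 < R := Real.rpow_pos_of_pos hm0 _
  have hRm : ENNReal.ofReal R = m ^ (1 / (k : ℝ)) := by
    rw [hR, ← ENNReal.ofReal_rpow_of_pos hm0, ENNReal.ofReal_toReal htop]
  have hsub : E ⊆ Metric.closedBall 0 R ∪ (E \ Metric.closedBall 0 R) := fun y hy => by
    by_cases h : y ∈ Metric.closedBall (0 : Rk k) R
    · exact Or.inl h
    · exact Or.inr ⟨hy, h⟩
  have hout : ∫⁻ y in E \ Metric.closedBall 0 R, ‖y‖ₑ ^ (-s) ≤ ENNReal.ofReal R ^ (-s) * m := by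
    calc ∫⁻ y in E \ Metric.closedBall 0 R, ‖y‖ₑ ^ (-s)
        ≤ ∫⁻ y in E \ Metric.closedBall 0 R, ENNReal.ofReal R ^ (-s) := by
          refine setLIntegral_mono measurable_const fun y hy => ?_
          have hy' : R ≤ ‖y‖ := by
            have := hy.2
            simp only [Metric.mem_closedBall, dist_zero_right, not_le] at this
            exact this.le
          rw [ENNReal.rpow_neg, ENNReal.rpow_neg, ENNReal.inv_le_inv, ← ofReal_norm]
          exact ENNReal.rpow_le_rpow (ENNReal.ofReal_le_ofReal hy') hs0
      _ = ENNReal.ofReal R ^ (-s) * volume (E \ Metric.closedBall 0 R) := by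
          rw [setLIntegral_const]
      _ ≤ _ := by gcongr; exact measure_mono Set.sdiff_subset
  calc ∫⁻ y in E, ‖y‖ₑ ^ (-s)
      ≤ ∫⁻ y in Metric.closedBall 0 R ∪ (E \ Metric.closedBall 0 R), ‖y‖ₑ ^ (-s) :=
        lintegral_mono_set hsub
    _ ≤ _ := lintegral_union_le _ _ _
    _ ≤ C * ENNReal.ofReal R ^ (k - s) + ENNReal.ofReal R ^ (-s) * m := add_le_add (hC R hR0) hout
    _ = (C + 1 : ℝ≥0) * m ^ (1 - s / k) := by
      rw [hRm, ← ENNReal.rpow_mul, ← ENNReal.rpow_mul]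
      nth_rewrite 3 [← ENNReal.rpow_one m]
      rw [← ENNReal.rpow_add _ _ h0 htop]
      have e1 : 1 / (k : ℝ) * (k - s) = 1 - s / k := by field_simp
      have e2 : 1 / (k : ℝ) * -s + 1 = 1 - s / k := by field_simp; ring
      rw [e1, e2]
      push_cast
      ring

/-- Hölder with weights θ and 1 - θ leaves the integral of |y|^{-L/(1-θ)} over E, and θ + L/k < 1
says exactly that L/(1-θ) < k. -/
theorem exists_setLIntegral_mul_rpow_le (hk : 1 ≤ k) {θ L : ℝ} (hθ0 : 0 < θ) (hθ1 : θ < 1)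
    (hL : 0 ≤ L) (hθL : θ + L / k < 1) :
    ∃ M : ℝ≥0, ∀ G : Rk k → ℝ≥0∞, Measurable G → ∫⁻ y, G y = 1 →
      ∀ E : Set (Rk k), MeasurableSet E →
        ∫⁻ y in E, G y ^ θ * ‖y‖ₑ ^ (-L) ≤ M * volume E ^ (1 - θ - L / k) := by
  have hk0 : (0 : ℝ) < k := by exact_mod_cast hk
  have h1 : 0 < 1 - θ := by linarith
  have hLk : L / (1 - θ) < k := by
    rw [div_lt_iff₀ h1]
    have : L / k < 1 - θ := by linarith
    rw [div_lt_iff₀ hk0] at this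
    linarith
  obtain ⟨C, hC⟩ := exists_setLIntegral_rpow_le hk (div_nonneg hL h1.le) hLk
  refine ⟨C ^ (1 - θ), fun G hG hG1 E hE => ?_⟩
  have hol := ENNReal.lintegral_mul_norm_pow_le (μ := volume.restrict E) (f := G)
    (g := fun y => ‖y‖ₑ ^ (-(L / (1 - θ)))) hG.aemeasurable (by fun_prop) hθ0.le h1.le (by ring)
  calc ∫⁻ y in E, G y ^ θ * ‖y‖ₑ ^ (-L)
      = ∫⁻ y in E, G y ^ θ * (‖y‖ₑ ^ (-(L / (1 - θ)))) ^ (1 - θ) := by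
        refine lintegral_congr fun y => ?_
        rw [← ENNReal.rpow_mul]
        congr 2
        field_simp
    _ ≤ _ := hol
    _ ≤ 1 ^ θ * (C * volume E ^ (1 - L / (1 - θ) / k)) ^ (1 - θ) := by
        gcongr
        · exact (setLIntegral_le_lintegral _ _).trans hG1.le
        · exact hC E hE
    _ = _ := by
        rw [ENNReal.one_rpow, one_mul, ENNReal.mul_rpow_of_nonneg _ _ h1.le, ← ENNReal.rpow_mul,
          ENNReal.coe_rpow_of_nonneg _ h1.le]
        congr 2
        field_simp

/-- If `∫_E h ≤ M |E|^κ` for all `E` and `∫ g ≤ c`, then the integral of `h g^β` over `{g ≤ A}` is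
at most a constant times `A^(β-κ)`. -/
theorem exists_lintegral_truncation_le {κ β : ℝ} (hκ : 0 ≤ κ) (hβ : κ < β) (M c : ℝ≥0) :
    ∃ C : ℝ≥0, ∀ h g : Rk k → ℝ≥0∞, Measurable h → Measurable g →
      (∀ E : Set (Rk k), MeasurableSet E → ∫⁻ y in E, h y ≤ M * volume E ^ κ) →
      ∫⁻ y, g y ≤ c → ∀ A : ℝ≥0∞,
        ∫⁻ y in {y | g y ≤ A}, h y * g y ^ β ≤ C * A ^ (β - κ) := by
  have hβ0 : 0 < β := hκ.trans_lt hβ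
  have hd : 0 < β - κ := sub_pos.2 hβ
  set q : ℝ≥0∞ := (2⁻¹ : ℝ≥0∞) ^ (β - κ) with hq
  have hq1 : q < 1 := ENNReal.rpow_lt_one (by simp) hd
  -- The summand 1 keeps K nonzero, so that the bound is ∞ when A = ∞.
  set K : ℝ≥0∞ := M * (2 * c) ^ κ * (1 - q)⁻¹ + 1 with hK
  have hKtop : K ≠ ∞ := by
    refine ENNReal.add_ne_top.2 ⟨ENNReal.mul_ne_top (ENNReal.mul_ne_top ENNReal.coe_ne_top
      (ENNReal.rpow_ne_top_of_nonneg hκ (ENNReal.mul_ne_top (by simp) ENNReal.coe_ne_top))) ?_,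
      by simp⟩
    exact ENNReal.inv_ne_top.2 (tsub_pos_of_lt hq1).ne'
  have hK0 : K ≠ 0 := by simp [hK]
  refine ⟨K.toNNReal, fun h g hh hg hE hgc A => ?_⟩
  rw [ENNReal.coe_toNNReal hKtop]
  rcases eq_or_ne A ∞ with rfl | hA
  · rw [ENNReal.top_rpow_of_pos hd, ENNReal.mul_top hK0]
    exact le_top
  rcases eq_or_ne A 0 with rfl | hA0
  · refine le_of_eq_of_le ?_ zero_le
    have hms : MeasurableSet {y | g y ≤ 0} := hg measurableSet_Iic
    rw [setLIntegral_congr_fun (g := fun _ => 0) hms (fun y hy => ?_), lintegral_zero]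
    have : g y = 0 := le_antisymm hy zero_le
    simp [this, ENNReal.zero_rpow_of_pos hβ0]
  -- Dyadic levels of g below A. By Chebyshev |{g ≥ a_{n+1}}| ≤ c / a_{n+1}, so level n contributes
  -- a multiple of a_n^{β-κ}, a geometric series because β > κ.
  set a : ℕ → ℝ≥0∞ := fun n => A * 2⁻¹ ^ n with ha
  have ha0 : ∀ n, a n ≠ 0 := fun n => mul_ne_zero hA0 (pow_ne_zero _ (by simp))
  have hatop : ∀ n, a n ≠ ∞ := fun n =>
    ENNReal.mul_ne_top hA (ENNReal.pow_ne_top (by simp))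
  have hlim : Filter.Tendsto a Filter.atTop (nhds 0) := by
    have := ENNReal.Tendsto.const_mul (a := A)
      (ENNReal.tendsto_pow_atTop_nhds_zero_of_lt_one (r := 2⁻¹) (by simp)) (Or.inr hA)
    simpa [ha] using this
  have hms : ∀ n, MeasurableSet {y | a (n + 1) ≤ g y} := fun n => hg measurableSet_Ici
  have hpt : ∀ y, g y ≤ A → h y * g y ^ β
      ≤ ∑' n, {y | a (n + 1) ≤ g y}.indicator (fun y => a n ^ β * h y) y := by
    intro y hy
    rcases eq_or_ne (g y) 0 with h0 | h0
    · simp [h0, ENNReal.zero_rpow_of_pos hβ0]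
    · have hex : ∃ n, a (n + 1) ≤ g y :=
        (((hlim.comp (Filter.tendsto_add_atTop_nat 1)).eventually_lt_const
          (pos_iff_ne_zero.2 h0)).exists).imp fun n hn => le_of_lt hn
      classical
      set n := Nat.find hex with hn
      have h1 : a (n + 1) ≤ g y := Nat.find_spec hex
      have h2 : g y ≤ a n := by
        rcases Nat.eq_zero_or_pos n with h | h
        · rw [h]; simpa [ha] using hy
        · have := Nat.find_min hex (m := n - 1) (by omega)
          rw [Nat.sub_add_cancel h] at this
          exact (not_le.1 this).le
      refine le_trans ?_ (ENNReal.le_tsum n)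
      rw [Set.indicator_of_mem (by exact h1), mul_comm]
      gcongr
  have hterm : ∀ n, ∫⁻ y in {y | a (n + 1) ≤ g y}, a n ^ β * h y
      ≤ M * (2 * c) ^ κ * A ^ (β - κ) * q ^ n := by
    intro n
    have hvol : volume {y | a (n + 1) ≤ g y} ≤ c / a (n + 1) :=
      (meas_ge_le_lintegral_div hg.aemeasurable (ha0 _) (hatop _)).trans (by gcongr)
    have hq' : q ^ n = (2⁻¹ ^ n : ℝ≥0∞) ^ (β - κ) := by
      rw [hq, ← ENNReal.rpow_natCast, ← ENNReal.rpow_natCast, ← ENNReal.rpow_mul,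
        ← ENNReal.rpow_mul, mul_comm]
    have hc : (c : ℝ≥0∞) / a (n + 1) = 2 * c * (a n)⁻¹ := by
      rw [div_eq_mul_inv]
      simp only [ha, pow_succ, ← mul_assoc]
      rw [ENNReal.mul_inv (Or.inr (by simp)) (Or.inr (by simp)), inv_inv]
      ring
    rw [lintegral_const_mul _ hh]
    calc a n ^ β * ∫⁻ y in {y | a (n + 1) ≤ g y}, h y
        ≤ a n ^ β * (M * (2 * c * (a n)⁻¹) ^ κ) := by
          gcongr
          refine (hE _ (hms n)).trans ?_
          gcongr
          exact hvol.trans hc.le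
      _ = M * (2 * c) ^ κ * (a n ^ β * a n ^ (-κ)) := by
          rw [ENNReal.mul_rpow_of_nonneg _ _ hκ, ENNReal.inv_rpow, ENNReal.rpow_neg]
          ring
      _ = _ := by
          rw [← ENNReal.rpow_add _ _ (ha0 n) (hatop n), ← sub_eq_add_neg, hq',
            ENNReal.mul_rpow_of_nonneg _ _ hd.le]
          ring
  calc ∫⁻ y in {y | g y ≤ A}, h y * g y ^ β
      ≤ ∫⁻ y in {y | g y ≤ A}, ∑' n, {y | a (n + 1) ≤ g y}.indicator (fun y => a n ^ β * h y) y :=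
        setLIntegral_mono' (hg measurableSet_Iic) hpt
    _ ≤ ∫⁻ y, ∑' n, {y | a (n + 1) ≤ g y}.indicator (fun y => a n ^ β * h y) y :=
        setLIntegral_le_lintegral _ _
    _ = ∑' n, ∫⁻ y in {y | a (n + 1) ≤ g y}, a n ^ β * h y := by
        rw [lintegral_tsum fun n => ((hh.const_mul _).indicator (hms n)).aemeasurable]
        exact tsum_congr fun n => lintegral_indicator (hms n) _
    _ ≤ ∑' n, M * (2 * c) ^ κ * A ^ (β - κ) * q ^ n := ENNReal.tsum_le_tsum hterm
    _ = M * (2 * c) ^ κ * (1 - q)⁻¹ * A ^ (β - κ) := by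
        rw [ENNReal.tsum_mul_left, ENNReal.tsum_geometric]; ring
    _ ≤ K * A ^ (β - κ) := by gcongr; exact le_self_add

/-- Fix u·x. The condition G ≤ F truncates G at the height F(u·x), so integrating over z·x produces
F^{β-κ}; the total power α + β - κ of F is 1. The half F ≤ G follows by exchanging the roles of F
and G. -/
theorem exists_lintegral_half_le {u w z : Fin 2 → ℝ} (huz : LinearIndependent ℝ ![u, z])
    (huw : LinearIndependent ℝ ![u, w]) {κ α β : ℝ} (hκ : 0 ≤ κ) (hα : κ < α) (hβ : κ < β)
    (hαβ : α + β = 1 + κ) (M : ℝ≥0) :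
    ∃ D : ℝ≥0, ∀ h F G : Rk k → ℝ≥0∞, Measurable h → Measurable F → Measurable G →
      (∀ E : Set (Rk k), MeasurableSet E → ∫⁻ y in E, h y ≤ M * volume E ^ κ) →
      ∫⁻ y, F y = 1 → ∫⁻ y, G y = 1 →
      ∫⁻ x in {x : Rk k × Rk k | G (pairing w x) ≤ F (pairing u x)},
        h (pairing z x) * F (pairing u x) ^ α * G (pairing w x) ^ β ≤ D := by
  obtain ⟨c, hc⟩ := exists_lintegral_pairing_eq (k := k) huz
  obtain ⟨a, b, hb, hab⟩ := exists_pairing_eq_combination (k := k) huz huw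
  obtain ⟨C, hC⟩ := exists_lintegral_truncation_le (k := k) hκ hβ M |(b ^ k)⁻¹|.toNNReal
  refine ⟨c * C, fun h F G hh hF hG hE hF1 hG1 => ?_⟩
  have hα0 : 0 ≤ α := hκ.trans hα.le
  have hmG : Measurable fun p : Rk k × Rk k => G (a • p.1 + b • p.2) := hG.comp (by fun_prop)
  have hmF : Measurable fun p : Rk k × Rk k => F p.1 := hF.comp measurable_fst
  have hmh : Measurable fun p : Rk k × Rk k => h p.2 := hh.comp measurable_snd
  set S : Set (Rk k × Rk k) := {p | G (a • p.1 + b • p.2) ≤ F p.1} with hS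
  have hSm : MeasurableSet S := measurableSet_le hmG hmF
  set Φ : Rk k × Rk k → ℝ≥0∞ := S.indicator
    fun p => h p.2 * F p.1 ^ α * G (a • p.1 + b • p.2) ^ β with hΦ
  have hΦm : Measurable Φ :=
    ((hmh.mul (hmF.pow_const α)).mul (hmG.pow_const β)).indicator hSm
  have hdom : MeasurableSet {x : Rk k × Rk k | G (pairing w x) ≤ F (pairing u x)} :=
    measurableSet_le (hG.comp (measurable_pairing w)) (hF.comp (measurable_pairing u))
  have h1 : ∫⁻ x in {x : Rk k × Rk k | G (pairing w x) ≤ F (pairing u x)},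
      h (pairing z x) * F (pairing u x) ^ α * G (pairing w x) ^ β
      = ∫⁻ x, Φ (pairing u x, pairing z x) := by
    rw [← lintegral_indicator hdom]
    refine lintegral_congr fun x => ?_
    simp only [hΦ, hS, Set.indicator, Set.mem_ofPred_eq, ← hab x]
  rw [h1, hc Φ hΦm, Measure.volume_eq_prod, lintegral_prod _ hΦm.aemeasurable]
  push_cast
  gcongr
  calc ∫⁻ p, ∫⁻ y, Φ (p, y) ≤ ∫⁻ p, C * F p := by
        refine lintegral_mono fun p => ?_
        have hm1 : Measurable fun y => G (a • p + b • y) := hG.comp (by fun_prop)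
        have hm2 : MeasurableSet {y | G (a • p + b • y) ≤ F p} := hm1 measurableSet_Iic
        calc ∫⁻ y, Φ (p, y)
            = ∫⁻ y in {y | G (a • p + b • y) ≤ F p}, F p ^ α * (h y * G (a • p + b • y) ^ β) := by
              rw [← lintegral_indicator hm2]
              refine lintegral_congr fun y => ?_
              simp only [hΦ, hS, Set.indicator, Set.mem_ofPred_eq]
              split_ifs
              · ring
              · rfl
          _ = F p ^ α * ∫⁻ y in {y | G (a • p + b • y) ≤ F p}, h y * G (a • p + b • y) ^ β :=
              lintegral_const_mul _ (hh.mul (hm1.pow_const β))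
          _ ≤ F p ^ α * (C * F p ^ (β - κ)) := by
              gcongr
              refine hC h _ hh hm1 hE ?_ (F p)
              rw [lintegral_comp_affine G hG _ hb, hG1, mul_one]
              rfl
          _ = C * (F p ^ α * F p ^ (β - κ)) := by ring
          _ = C * F p := by
              rw [← ENNReal.rpow_add_of_nonneg _ _ hα0 (by linarith)]
              have : α + (β - κ) = 1 := by linarith
              rw [this, ENNReal.rpow_one]
    _ = C := by rw [lintegral_const_mul _ hF, hF1, mul_one]

/-- A Hardy–Littlewood–Sobolev inequality: the kernel `h` is only assumed to satisfy the
weak-type condition `∫_E h ≤ M |E|^κ`. -/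
theorem exists_lintegral_weakKernel_le {u w z : Fin 2 → ℝ} (huz : LinearIndependent ℝ ![u, z])
    (hwz : LinearIndependent ℝ ![w, z]) (huw : LinearIndependent ℝ ![u, w])
    (hwu : LinearIndependent ℝ ![w, u]) {κ α β : ℝ} (hκ : 0 ≤ κ) (hα : κ < α) (hβ : κ < β)
    (hαβ : α + β = 1 + κ) (M : ℝ≥0) :
    ∃ D : ℝ≥0, ∀ h F G : Rk k → ℝ≥0∞, Measurable h → Measurable F → Measurable G →
      (∀ E : Set (Rk k), MeasurableSet E → ∫⁻ y in E, h y ≤ M * volume E ^ κ) →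
      ∫⁻ y, F y = 1 → ∫⁻ y, G y = 1 →
      ∫⁻ x : Rk k × Rk k,
        h (pairing z x) * F (pairing u x) ^ α * G (pairing w x) ^ β ≤ D := by
  obtain ⟨D₁, h₁⟩ := exists_lintegral_half_le (k := k) huz huw hκ hα hβ hαβ M
  obtain ⟨D₂, h₂⟩ := exists_lintegral_half_le (k := k) hwz hwu hκ hβ hα (by linarith) M
  refine ⟨D₁ + D₂, fun h F G hh hF hG hE hF1 hG1 => ?_⟩
  have hcover : (Set.univ : Set (Rk k × Rk k)) ⊆ {x | G (pairing w x) ≤ F (pairing u x)} ∪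
      {x | F (pairing u x) ≤ G (pairing w x)} := fun x _ => by
    simpa using le_total _ _
  calc _ = ∫⁻ x : Rk k × Rk k in Set.univ,
        h (pairing z x) * F (pairing u x) ^ α * G (pairing w x) ^ β := by rw [setLIntegral_univ]
    _ ≤ _ := (lintegral_mono_set hcover).trans (lintegral_union_le _ _ _)
    _ ≤ D₁ + D₂ := by
      refine add_le_add (h₁ h F G hh hF hG hE hF1 hG1) ?_
      refine le_of_eq_of_le ?_ (h₂ h G F hh hG hF hE hG1 hF1)
      exact lintegral_congr fun x => by ring
    _ = _ := by push_cast; rfl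

end WeakKernel

/-! ### Finite families of constants, powers, and Hölder convexity -/

theorem exists_uniform_bound {ι : Type*} [Fintype ι] {P : ι → ℝ≥0 → Prop}
    (hmono : ∀ i a b, a ≤ b → P i a → P i b) (h : ∀ i, ∃ c, P i c) : ∃ c, ∀ i, P i c := by
  choose c hc using h
  exact ⟨∑ i, c i, fun i => hmono i _ _
    (Finset.single_le_sum (fun _ _ => zero_le) (Finset.mem_univ i)) (hc i)⟩

theorem ENNReal.prod_rpow_eq_rpow_sum {ι : Type*} (s : Finset ι) {a : ℝ≥0∞} (h0 : a ≠ 0)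
    (htop : a ≠ ∞) (e : ι → ℝ) : ∏ j ∈ s, a ^ e j = a ^ ∑ j ∈ s, e j := by
  classical
  induction s using Finset.induction_on with
  | empty => simp
  | insert i s hi ih => rw [Finset.prod_insert hi, Finset.sum_insert hi, ih, ENNReal.rpow_add _ _ h0 htop]

theorem ENNReal.prod_rpow_single_add_single {ι : Type*} [Fintype ι] [DecidableEq ι]
    (g : ι → ℝ≥0∞) {i j : ι} (hij : i ≠ j) (α β : ℝ) :
    ∏ m, g m ^ (Pi.single i α + Pi.single j β : ι → ℝ) m = g i ^ α * g j ^ β := by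
  rw [Finset.prod_eq_mul i j hij]
  · simp [hij, hij.symm]
  · rintro m - ⟨hmi, hmj⟩; simp [hmi, hmj]
  · simp
  · simp

theorem ENNReal.rpow_neg_le_of_le_mul {u x : ℝ≥0∞} {C : ℝ≥0} (hC : C ≠ 0) (h : u ≤ C * x) {s : ℝ}
    (hs : 0 ≤ s) : x ^ (-s) ≤ C ^ s * u ^ (-s) := by
  have hC0 : (C : ℝ≥0∞) ^ s ≠ 0 := by
    simp [ENNReal.rpow_eq_zero_iff, hC]
  have hCt : (C : ℝ≥0∞) ^ s ≠ ∞ := ENNReal.rpow_ne_top_of_nonneg hs ENNReal.coe_ne_top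
  have h1 : u ^ s ≤ C ^ s * x ^ s := by
    rw [← ENNReal.mul_rpow_of_nonneg _ _ hs]
    exact ENNReal.rpow_le_rpow h hs
  rw [ENNReal.rpow_neg, ENNReal.rpow_neg]
  calc (x ^ s)⁻¹ = C ^ s * (C ^ s * x ^ s)⁻¹ := by
        rw [ENNReal.mul_inv (Or.inl hC0) (Or.inl hCt), ← mul_assoc,
          ENNReal.mul_inv_cancel hC0 hCt, one_mul]
    _ ≤ _ := by gcongr

theorem ENNReal.rpow_neg_le_of_comparable {u x : ℝ≥0∞} {C : ℝ≥0} (hC : C ≠ 0) (h : u ≤ C * x)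
    (h' : x ≤ C * u) (s : ℝ) : u ^ (-s) ≤ C ^ |s| * x ^ (-s) := by
  rcases le_total 0 s with hs | hs
  · rw [abs_of_nonneg hs]; exact ENNReal.rpow_neg_le_of_le_mul hC h' hs
  · rw [abs_of_nonpos hs, ← ENNReal.mul_rpow_of_nonneg _ _ (by linarith)]
    exact ENNReal.rpow_le_rpow h (by linarith)

/-- By Hölder's inequality, a bound for `∫ K ∏ gⱼ^σⱼ` holds for a convex set of exponents. -/
theorem convex_setOf_lintegral_prod_rpow_le {X ι : Type*} [MeasurableSpace X] [Fintype ι]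
    (μ : Measure X) {K : X → ℝ≥0∞} (hK : Measurable K) {g : ι → X → ℝ≥0∞}
    (hg : ∀ j, Measurable (g j)) (D : ℝ≥0∞) :
    Convex ℝ {σ : ι → ℝ | (∀ j, 0 ≤ σ j) ∧ ∫⁻ x, K x * ∏ j, g j x ^ σ j ∂μ ≤ D} := by
  have hm : ∀ σ : ι → ℝ, Measurable fun x => K x * ∏ j, g j x ^ σ j := fun σ =>
    hK.mul (Finset.measurable_fun_prod _ fun j _ => (hg j).pow_const _)
  rintro σ ⟨hσ, hσD⟩ τ ⟨hτ, hτD⟩ a b ha hb hab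
  refine ⟨fun j => add_nonneg (mul_nonneg ha (hσ j)) (mul_nonneg hb (hτ j)), ?_⟩
  calc ∫⁻ x, K x * ∏ j, g j x ^ (a • σ + b • τ) j ∂μ
      = ∫⁻ x, (K x * ∏ j, g j x ^ σ j) ^ a * (K x * ∏ j, g j x ^ τ j) ^ b ∂μ := by
        refine lintegral_congr fun x => ?_
        rw [ENNReal.mul_rpow_of_nonneg _ _ ha, ENNReal.mul_rpow_of_nonneg _ _ hb,
          mul_mul_mul_comm, ← ENNReal.rpow_add_of_nonneg _ _ ha hb, hab, ENNReal.rpow_one,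
          ← ENNReal.prod_rpow_of_nonneg ha, ← ENNReal.prod_rpow_of_nonneg hb,
          ← Finset.prod_mul_distrib]
        congr 1
        refine Finset.prod_congr rfl fun j _ => ?_
        rw [← ENNReal.rpow_mul, ← ENNReal.rpow_mul,
          ← ENNReal.rpow_add_of_nonneg _ _ (mul_nonneg (hσ j) ha) (mul_nonneg (hτ j) hb)]
        congr 1
        simp only [Pi.add_apply, Pi.smul_apply, smul_eq_mul]
        ring
    _ ≤ _ := ENNReal.lintegral_mul_norm_pow_le (hm σ).aemeasurable (hm τ).aemeasurable ha hb hab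
    _ ≤ D ^ a * D ^ b := by gcongr
    _ = D := by rw [← ENNReal.rpow_add_of_nonneg _ _ ha hb, hab, ENNReal.rpow_one]

/-! ### The unweighted form and the form with one weight -/

section Forms

variable {k N : ℕ} {v : Fin N → Fin 2 → ℝ}

theorem two_le_card_of_sum {ι : Type*} {s : Finset ι} {σ : ι → ℝ} (h1 : ∀ j, σ j ≤ 1)
    (h : 1 < ∑ j ∈ s, σ j) : 2 ≤ s.card := by
  have h2 : ∑ j ∈ s, σ j ≤ s.card := by
    simpa using Finset.sum_le_sum fun j (_ : j ∈ s) => h1 j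
  have : (1 : ℝ) < s.card := h.trans_le h2
  exact_mod_cast this

/-- The unweighted form is bounded when the exponents lie in `[0, 1]` and add up to `2`. -/
theorem exists_lintegral_prod_rpow_le (hv : ∀ i j, i ≠ j → LinearIndependent ℝ ![v i, v j]) :
    ∃ D : ℝ≥0, ∀ G : Fin N → Rk k → ℝ≥0∞, (∀ j, Measurable (G j)) → (∀ j, ∫⁻ y, G j y = 1) →
      ∀ τ : Fin N → ℝ, (∀ j, 0 ≤ τ j) → (∀ j, τ j ≤ 1) → ∑ j, τ j = 2 →
        ∫⁻ x : Rk k × Rk k, ∏ j, G j (pairing (v j) x) ^ τ j ≤ D := by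
  obtain ⟨D, hD⟩ := exists_uniform_bound (ι := Fin N × Fin N)
    (P := fun q c => q.1 ≠ q.2 → ∀ F G : Rk k → ℝ≥0∞, Measurable F → Measurable G →
      ∫⁻ y, F y = 1 → ∫⁻ y, G y = 1 →
      ∫⁻ x : Rk k × Rk k, F (pairing (v q.1) x) * G (pairing (v q.2) x) ≤ c)
    (fun q a b hab h hq F G hF hG h1 h2 => (h hq F G hF hG h1 h2).trans (by exact_mod_cast hab))
    (fun q => by
      by_cases hq : q.1 = q.2
      · exact ⟨0, fun h => (h hq).elim⟩
      obtain ⟨c, hc⟩ := exists_lintegral_pairing_eq (k := k) (hv _ _ hq)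
      refine ⟨c, fun _ F G hF hG h1 h2 => ?_⟩
      have := hc (fun z => F z.1 * G z.2)
        ((hF.comp measurable_fst).mul (hG.comp measurable_snd))
      rw [this, Measure.volume_eq_prod, lintegral_prod_mul hF.aemeasurable hG.aemeasurable,
        h1, h2]
      simp)
  refine ⟨D, fun G hG hG1 τ h0 h1 hsum => ?_⟩
  have hconv := convex_setOf_lintegral_prod_rpow_le (volume : Measure (Rk k × Rk k))
    (K := fun _ => 1) measurable_const
    (g := fun j x => G j (pairing (v j) x)) (fun j => (hG j).comp (measurable_pairing _)) D
  -- With α = 1 and S = 2 the vertices are e_i + e_j, where the form factors into ∫ G_i ∫ G_j up to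
  -- a Jacobian.
  have := mem_of_convex_of_vertices hconv (J := Finset.univ)
    (two_le_card_of_sum h1 (by linarith)) one_pos (S := 2)
    (by norm_num) (by norm_num) (fun i _ j _ hij => ⟨fun m => ?_, ?_⟩) τ h0 h1 (by simp) hsum
  · simpa using this.2
  · rw [Pi.add_apply, Pi.single_apply, Pi.single_apply]
    split_ifs <;> norm_num
  · have e : (2 : ℝ) - 1 = 1 := by norm_num
    simp only [ENNReal.prod_rpow_single_add_single _ hij, e, ENNReal.rpow_one, one_mul]
    exact hD (i, j) hij (G i) (G j) (hG i) (hG j) (hG1 i) (hG1 j)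

/-- The form with the single weight `|v_l · x|^(-L)`. -/
theorem exists_lintegral_singleWeight_le (hk : 1 ≤ k)
    (hv : ∀ i j, i ≠ j → LinearIndependent ℝ ![v i, v j]) (l : Fin N) {θ : Fin N → ℝ} {L : ℝ}
    (hθ0 : ∀ j, 0 < θ j) (hθ1 : ∀ j, θ j < 1) (hL : 0 ≤ L) (hl : θ l + L / k < 1)
    (hsum : ∑ j, θ j = 2 - L / k) :
    ∃ D : ℝ≥0, ∀ G : Fin N → Rk k → ℝ≥0∞, (∀ j, Measurable (G j)) → (∀ j, ∫⁻ y, G j y = 1) →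
      ∫⁻ x : Rk k × Rk k, ‖pairing (v l) x‖ₑ ^ (-L) * ∏ j, G j (pairing (v j) x) ^ θ j ≤ D := by
  obtain ⟨M, hM⟩ := exists_setLIntegral_mul_rpow_le hk (hθ0 l) (hθ1 l) hL hl
  set κ := 1 - θ l - L / k with hκ
  have hκ0 : 0 < κ := by linarith
  have hκ1 : κ < 1 := by
    have : 0 ≤ L / k := by positivity
    linarith [hθ0 l]
  set S := 1 + κ with hS
  -- The vertices are α e_i + (S - α) e_j. Here α < 1 gives S - α > κ, and α > S/2 gives both S ≤ 2α
  -- and α > κ; θ_j ≤ α places the exponents in the polytope.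
  obtain ⟨α, hθα, hαS, hα1⟩ : ∃ α : ℝ, (∀ j, θ j ≤ α) ∧ S / 2 < α ∧ α < 1 := by
    have h1 : ∀ᶠ α in nhdsWithin (1 : ℝ) (Set.Iio 1), ∀ j, α ∈ Set.Ioo (θ j) 1 :=
      Filter.eventually_all.2 fun j => Ioo_mem_nhdsLT (hθ1 j)
    have h2 : ∀ᶠ α in nhdsWithin (1 : ℝ) (Set.Iio 1), α ∈ Set.Ioo (S / 2) 1 :=
      Ioo_mem_nhdsLT (by linarith)
    obtain ⟨α, h1, h2⟩ := (h1.and h2).exists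
    exact ⟨α, fun j => (h1 j).1.le, h2.1, h2.2⟩
  obtain ⟨D, hD⟩ := exists_uniform_bound (ι := Fin N × Fin N)
    (P := fun q c => q.1 ≠ q.2 → q.1 ≠ l → q.2 ≠ l →
      ∀ h F G : Rk k → ℝ≥0∞, Measurable h → Measurable F → Measurable G →
      (∀ E : Set (Rk k), MeasurableSet E → ∫⁻ y in E, h y ≤ M * volume E ^ κ) →
      ∫⁻ y, F y = 1 → ∫⁻ y, G y = 1 →
      ∫⁻ x : Rk k × Rk k, h (pairing (v l) x) * F (pairing (v q.1) x) ^ α *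
        G (pairing (v q.2) x) ^ (S - α) ≤ c)
    (fun q a b hab H h1 h2 h3 h F G hh hF hG hE hF1 hG1 =>
      (H h1 h2 h3 h F G hh hF hG hE hF1 hG1).trans (by exact_mod_cast hab))
    (fun q => by
      by_cases hq : q.1 ≠ q.2 ∧ q.1 ≠ l ∧ q.2 ≠ l
      · obtain ⟨D, hD⟩ := exists_lintegral_weakKernel_le (k := k) (hv _ _ hq.2.1)
          (hv _ _ hq.2.2) (hv _ _ hq.1) (hv _ _ hq.1.symm) hκ0.le (α := α) (β := S - α)
          (by linarith) (by linarith) (by linarith) M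
        exact ⟨D, fun _ _ _ => hD⟩
      · exact ⟨0, fun h1 h2 h3 => (hq ⟨h1, h2, h3⟩).elim⟩)
  refine ⟨D, fun G hG hG1 => ?_⟩
  set h : Rk k → ℝ≥0∞ := fun y => G l y ^ θ l * ‖y‖ₑ ^ (-L) with hh
  have hhm : Measurable h := ((hG l).pow_const _).mul (by fun_prop)
  have hE := hM (G l) (hG l) (hG1 l)
  have hconv := convex_setOf_lintegral_prod_rpow_le (volume : Measure (Rk k × Rk k))
    (hhm.comp (measurable_pairing (v l)))
    (g := fun j x => G j (pairing (v j) x)) (fun j => (hG j).comp (measurable_pairing _)) D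
  -- The power G_l^{θ_l} has been absorbed into h, so index l is removed; the remaining exponents
  -- have sum S = 2 - θ_l - L/k.
  set σ := Function.update θ l 0 with hσ
  have hσl : σ l = 0 := by simp [hσ]
  have hσj : ∀ j, j ≠ l → σ j = θ j := fun j hj => by simp [hσ, hj]
  have hσsum : ∑ j ∈ Finset.univ.erase l, σ j = S := by
    have h1 : ∑ j ∈ Finset.univ.erase l, σ j = ∑ j ∈ Finset.univ.erase l, θ j :=
      Finset.sum_congr rfl fun j hj => hσj j (Finset.ne_of_mem_erase hj)
    have h2 := Finset.add_sum_erase Finset.univ θ (Finset.mem_univ l)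
    linarith
  have hσ1 : ∀ j, σ j ≤ α := fun j => by
    by_cases hj : j = l
    · subst hj; linarith
    · rw [hσj j hj]; exact hθα j
  have hσ0 : ∀ j, 0 ≤ σ j := fun j => by
    by_cases hj : j = l
    · subst hj; exact hσl.ge
    · rw [hσj j hj]; exact (hθ0 j).le
  have := mem_of_convex_of_vertices hconv (J := Finset.univ.erase l)
    (two_le_card_of_sum (fun j => (hσ1 j).trans hα1.le) (by linarith)) (by linarith) (S := S)
    (by linarith) (by linarith) (fun i hi j hj hij => ⟨fun m => ?_, ?_⟩) σ hσ0 hσ1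
    (fun j hj => by
      have : j = l := by simpa using hj
      rw [this, hσl])
    (by rw [← hσsum, ← Finset.add_sum_erase Finset.univ σ (Finset.mem_univ l), hσl, zero_add])
  · refine le_of_eq_of_le (lintegral_congr fun x => ?_) this.2
    rw [← Finset.mul_prod_erase _ _ (Finset.mem_univ l),
      ← Finset.mul_prod_erase _ _ (Finset.mem_univ l), hσl, ENNReal.rpow_zero, one_mul]
    simp only [Function.comp, hh]
    have e : ∏ j ∈ Finset.univ.erase l, G j (pairing (v j) x) ^ σ j
        = ∏ j ∈ Finset.univ.erase l, G j (pairing (v j) x) ^ θ j :=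
      Finset.prod_congr rfl fun j hj => by rw [hσj j (Finset.ne_of_mem_erase hj)]
    rw [e]
    ring
  · rw [Pi.add_apply, Pi.single_apply, Pi.single_apply]
    split_ifs <;> linarith
  · simp only [ENNReal.prod_rpow_single_add_single _ hij, ← mul_assoc, Function.comp]
    exact hD (i, j) hij (Finset.ne_of_mem_erase hi) (Finset.ne_of_mem_erase hj) h (G i) (G j) hhm
      (hG i) (hG j) hE (hG1 i) (hG1 j)

end Forms

/-! ### Estimates on the region where one pairing is smallest -/

/-- The region where `v_l · x` is nonzero and is the smallest of the `v_j · x`. -/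
def smallestRegion {k N : ℕ} (v : Fin N → Fin 2 → ℝ) (l : Fin N) : Set (Rk k × Rk k) :=
  {x | pairing (v l) x ≠ 0 ∧ ∀ j, ‖pairing (v l) x‖ ≤ ‖pairing (v j) x‖}

section Region

variable {k N : ℕ} {v : Fin N → Fin 2 → ℝ}

theorem measurableSet_smallestRegion (l : Fin N) :
    MeasurableSet (smallestRegion v l : Set (Rk k × Rk k)) := by
  have h1 : MeasurableSet {x : Rk k × Rk k | pairing (v l) x ≠ 0} :=
    (measurable_pairing (v l)) (measurableSet_singleton 0).compl
  have h2 : MeasurableSet {x : Rk k × Rk k | ∀ j, ‖pairing (v l) x‖ ≤ ‖pairing (v j) x‖} := by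
    have : {x : Rk k × Rk k | ∀ j, ‖pairing (v l) x‖ ≤ ‖pairing (v j) x‖}
        = ⋂ j, {x | ‖pairing (v l) x‖ ≤ ‖pairing (v j) x‖} := by ext; simp
    rw [this]
    exact MeasurableSet.iInter fun j =>
      measurableSet_le (measurable_pairing _).norm (measurable_pairing _).norm
  exact h1.inter h2

theorem exists_enorm_pairing_le (w : Fin 2 → ℝ) :
    ∃ C : ℝ≥0, C ≠ 0 ∧ ∀ x : Rk k × Rk k, ‖pairing w x‖ₑ ≤ C * ‖x‖ₑ := by
  obtain ⟨C, hC0, hC⟩ := exists_norm_pairing_le (k := k) w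
  refine ⟨C.toNNReal, by simpa using hC0, fun x => ?_⟩
  rw [← ofReal_norm, ← ofReal_norm, ← ENNReal.ofReal.eq_1, ← ENNReal.ofReal_mul hC0.le]
  exact ENNReal.ofReal_le_ofReal (hC x)

theorem exists_enorm_le_pairing {v w : Fin 2 → ℝ} (h : LinearIndependent ℝ ![v, w]) :
    ∃ C : ℝ≥0, C ≠ 0 ∧ ∀ x : Rk k × Rk k, ‖pairing v x‖ ≤ ‖pairing w x‖ →
      ‖x‖ₑ ≤ C * ‖pairing w x‖ₑ := by
  obtain ⟨C, hC0, hC⟩ := exists_norm_le_pairing (k := k) h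
  refine ⟨C.toNNReal, by simpa using hC0, fun x hx => ?_⟩
  rw [← ofReal_norm, ← ofReal_norm, ← ENNReal.ofReal.eq_1, ← ENNReal.ofReal_mul hC0.le]
  refine ENNReal.ofReal_le_ofReal ?_
  have := hC x
  rwa [max_eq_right hx] at this

/-- The kernel `|v_l · x|^(-γ) |x|^(γ-s)`. -/
noncomputable def regionKernel (v : Fin N → Fin 2 → ℝ) (l : Fin N) (s γ : ℝ) (x : Rk k × Rk k) : ℝ≥0∞ :=
  ‖pairing (v l) x‖ₑ ^ (-γ) * ‖x‖ₑ ^ (γ - s)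

theorem measurable_regionKernel (l : Fin N) (s γ : ℝ) :
    Measurable (regionKernel v l s γ : Rk k × Rk k → ℝ≥0∞) :=
  ((measurable_pairing _).enorm.pow_const _).mul (measurable_enorm.pow_const _)

/-- Since γ < k, |x|^{γ-k} is at most a multiple of |u|^{γ-k} with u = v_j·x. Integrating |y|^{-γ}
over |y| ≤ |u|, y = v_l·x, gives |u|^{k-γ}, which cancels it. -/
theorem exists_lintegral_regionKernel_le_of_ne (hk : 1 ≤ k) {l j : Fin N}
    (hjl : LinearIndependent ℝ ![v j, v l]) {γ : ℝ} (hγ : γ < k) :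
    ∃ D : ℝ≥0, ∀ G : Rk k → ℝ≥0∞, Measurable G → ∫⁻ y, G y = 1 →
      ∫⁻ x in smallestRegion v l, regionKernel v l k γ x * G (pairing (v j) x) ≤ D := by
  obtain ⟨c, hc⟩ := exists_lintegral_pairing_eq (k := k) hjl
  obtain ⟨C, hC0, hC⟩ := exists_enorm_pairing_le (k := k) (v j)
  obtain ⟨B, hB⟩ := exists_lintegral_closedBall_rpow_le hk hγ
  have hs : 0 ≤ (k : ℝ) - γ := by linarith
  refine ⟨c * (C ^ ((k : ℝ) - γ) * B), fun G hG hG1 => ?_⟩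
  set S : Set (Rk k × Rk k) := {p | p.1 ≠ 0 ∧ ‖p.2‖ ≤ ‖p.1‖} with hS
  have hSm : MeasurableSet S :=
    (measurable_fst (measurableSet_singleton (0 : Rk k)).compl).inter
      (measurableSet_le measurable_snd.norm measurable_fst.norm)
  set Φ : Rk k × Rk k → ℝ≥0∞ := S.indicator fun p =>
    G p.1 * (C ^ ((k : ℝ) - γ) * ‖p.1‖ₑ ^ (-((k : ℝ) - γ))) * ‖p.2‖ₑ ^ (-γ) with hΦ
  have hΦm : Measurable Φ :=
    (((hG.comp measurable_fst).mul ((measurable_fst.enorm.pow_const _).const_mul _)).mul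
      (measurable_snd.enorm.pow_const _)).indicator hSm
  calc ∫⁻ x in smallestRegion v l, regionKernel v l k γ x * G (pairing (v j) x)
      ≤ ∫⁻ x, Φ (pairing (v j) x, pairing (v l) x) := by
        rw [← lintegral_indicator (measurableSet_smallestRegion l)]
        refine lintegral_mono fun x => ?_
        by_cases hx : x ∈ smallestRegion v l
        · have h1 : (pairing (v j) x, pairing (v l) x) ∈ S := by
            refine ⟨fun h => hx.1 ?_, hx.2 j⟩
            have := hx.2 j
            simp only at h
            rw [h, norm_zero] at this
            exact norm_le_zero_iff.1 this
          simp only [Set.indicator_of_mem hx, hΦ, Set.indicator_of_mem h1, regionKernel]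
          have h2 := ENNReal.rpow_neg_le_of_le_mul hC0 (hC x) hs
          rw [neg_sub] at h2
          rw [neg_sub]
          calc ‖pairing (v l) x‖ₑ ^ (-γ) * ‖x‖ₑ ^ (γ - k) * G (pairing (v j) x)
              = G (pairing (v j) x) * ‖x‖ₑ ^ (γ - k) * ‖pairing (v l) x‖ₑ ^ (-γ) := by ring
            _ ≤ _ := by gcongr
        · rw [Set.indicator_of_notMem hx]; exact zero_le
    _ = c * ∫⁻ u, ∫⁻ y, Φ (u, y) := by
        rw [hc Φ hΦm, Measure.volume_eq_prod, lintegral_prod _ hΦm.aemeasurable]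
    _ ≤ c * ∫⁻ u, (C ^ ((k : ℝ) - γ) * B) * G u := by
        gcongr with u
        rcases eq_or_ne u 0 with hu | hu
        · have : ∀ y, Φ (u, y) = 0 := fun y => by simp [hΦ, hS, hu]
          simp [this]
        have hm : MeasurableSet (Metric.closedBall (0 : Rk k) ‖u‖) :=
          Metric.isClosed_closedBall.measurableSet
        have hu0 : 0 < ‖u‖ := norm_pos_iff.2 hu
        calc ∫⁻ y, Φ (u, y)
            = ∫⁻ y in Metric.closedBall (0 : Rk k) ‖u‖,
              G u * (C ^ ((k : ℝ) - γ) * ‖u‖ₑ ^ (-((k : ℝ) - γ))) * ‖y‖ₑ ^ (-γ) := by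
              rw [← lintegral_indicator hm]
              refine lintegral_congr fun y => ?_
              simp [hΦ, hS, Set.indicator, hu]
          _ = G u * (C ^ ((k : ℝ) - γ) * ‖u‖ₑ ^ (-((k : ℝ) - γ))) *
              ∫⁻ y in Metric.closedBall (0 : Rk k) ‖u‖, ‖y‖ₑ ^ (-γ) :=
              lintegral_const_mul _ (by fun_prop)
          _ ≤ G u * (C ^ ((k : ℝ) - γ) * ‖u‖ₑ ^ (-((k : ℝ) - γ))) *
              (B * ‖u‖ₑ ^ ((k : ℝ) - γ)) := by
              gcongr
              rw [← ofReal_norm]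
              exact hB _ hu0
          _ = C ^ ((k : ℝ) - γ) * B * G u *
              (‖u‖ₑ ^ (-((k : ℝ) - γ)) * ‖u‖ₑ ^ ((k : ℝ) - γ)) := by ring
          _ = _ := by
              rw [← ENNReal.rpow_add _ _ (by simpa using hu) (by simp), neg_add_cancel,
                ENNReal.rpow_zero, mul_one]
    _ = _ := by
        rw [lintegral_const_mul _ hG, hG1, mul_one]
        push_cast
        rw [ENNReal.coe_rpow_of_nonneg _ hs]

/-- Now u = v_l·x is held fixed and y = v_j·x ranges over |y| ≥ |u|, for an auxiliary index j. The
tail integral of |y|^{γ-k} is a multiple of |u|^γ, which cancels |u|^{-γ}; it converges because γ <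
0. -/
theorem exists_lintegral_regionKernel_le_self (hk : 1 ≤ k) {l j : Fin N}
    (hlj : LinearIndependent ℝ ![v l, v j]) {γ : ℝ} (hγ : γ < 0) :
    ∃ D : ℝ≥0, ∀ G : Rk k → ℝ≥0∞, Measurable G → ∫⁻ y, G y = 1 →
      ∫⁻ x in smallestRegion v l, regionKernel v l k γ x * G (pairing (v l) x) ≤ D := by
  obtain ⟨c, hc⟩ := exists_lintegral_pairing_eq (k := k) hlj
  obtain ⟨C, hC0, hC⟩ := exists_enorm_pairing_le (k := k) (v j)
  obtain ⟨B, hB⟩ := exists_lintegral_compl_ball_rpow_le hk hγ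
  have hs : 0 ≤ (k : ℝ) - γ := by have : (0 : ℝ) ≤ k := by positivity
                                  linarith
  refine ⟨c * (C ^ ((k : ℝ) - γ) * B), fun G hG hG1 => ?_⟩
  set S : Set (Rk k × Rk k) := {p | p.1 ≠ 0 ∧ ‖p.1‖ ≤ ‖p.2‖} with hS
  have hSm : MeasurableSet S :=
    (measurable_fst (measurableSet_singleton (0 : Rk k)).compl).inter
      (measurableSet_le measurable_fst.norm measurable_snd.norm)
  set Φ : Rk k × Rk k → ℝ≥0∞ := S.indicator fun p =>
    G p.1 * (C ^ ((k : ℝ) - γ) * ‖p.1‖ₑ ^ (-γ)) * ‖p.2‖ₑ ^ (γ - k) with hΦ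
  have hΦm : Measurable Φ :=
    (((hG.comp measurable_fst).mul ((measurable_fst.enorm.pow_const _).const_mul _)).mul
      (measurable_snd.enorm.pow_const _)).indicator hSm
  calc ∫⁻ x in smallestRegion v l, regionKernel v l k γ x * G (pairing (v l) x)
      ≤ ∫⁻ x, Φ (pairing (v l) x, pairing (v j) x) := by
        rw [← lintegral_indicator (measurableSet_smallestRegion l)]
        refine lintegral_mono fun x => ?_
        by_cases hx : x ∈ smallestRegion v l
        · have h1 : (pairing (v l) x, pairing (v j) x) ∈ S := ⟨hx.1, hx.2 j⟩
          simp only [Set.indicator_of_mem hx, hΦ, Set.indicator_of_mem h1, regionKernel]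
          have h2 := ENNReal.rpow_neg_le_of_le_mul hC0 (hC x) hs
          rw [neg_sub] at h2
          calc ‖pairing (v l) x‖ₑ ^ (-γ) * ‖x‖ₑ ^ (γ - k) * G (pairing (v l) x)
              ≤ ‖pairing (v l) x‖ₑ ^ (-γ) *
                (C ^ ((k : ℝ) - γ) * ‖pairing (v j) x‖ₑ ^ (γ - k)) * G (pairing (v l) x) := by
                gcongr
            _ = _ := by ring
        · rw [Set.indicator_of_notMem hx]; exact zero_le
    _ = c * ∫⁻ u, ∫⁻ y, Φ (u, y) := by
        rw [hc Φ hΦm, Measure.volume_eq_prod, lintegral_prod _ hΦm.aemeasurable]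
    _ ≤ c * ∫⁻ u, (C ^ ((k : ℝ) - γ) * B) * G u := by
        gcongr with u
        rcases eq_or_ne u 0 with hu | hu
        · have : ∀ y, Φ (u, y) = 0 := fun y => by simp [hΦ, hS, hu]
          simp [this]
        have hm : MeasurableSet {y : Rk k | ‖u‖ ≤ ‖y‖} :=
          measurableSet_le measurable_const measurable_norm
        have hu0 : 0 < ‖u‖ := norm_pos_iff.2 hu
        calc ∫⁻ y, Φ (u, y)
            = ∫⁻ y in {y : Rk k | ‖u‖ ≤ ‖y‖},
              G u * (C ^ ((k : ℝ) - γ) * ‖u‖ₑ ^ (-γ)) * ‖y‖ₑ ^ (γ - k) := by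
              rw [← lintegral_indicator hm]
              refine lintegral_congr fun y => ?_
              simp [hΦ, hS, Set.indicator, hu]
          _ = G u * (C ^ ((k : ℝ) - γ) * ‖u‖ₑ ^ (-γ)) *
              ∫⁻ y in {y : Rk k | ‖u‖ ≤ ‖y‖}, ‖y‖ₑ ^ (γ - k) :=
              lintegral_const_mul _ (by fun_prop)
          _ ≤ G u * (C ^ ((k : ℝ) - γ) * ‖u‖ₑ ^ (-γ)) * (B * ‖u‖ₑ ^ γ) := by
              gcongr
              rw [← ofReal_norm]
              exact hB _ hu0
          _ = C ^ ((k : ℝ) - γ) * B * G u * (‖u‖ₑ ^ (-γ) * ‖u‖ₑ ^ γ) := by ring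
          _ = _ := by
              rw [← ENNReal.rpow_add _ _ (by simpa using hu) (by simp), neg_add_cancel,
                ENNReal.rpow_zero, mul_one]
    _ = _ := by
        rw [lintegral_const_mul _ hG, hG1, mul_one]
        push_cast
        rw [ENNReal.coe_rpow_of_nonneg _ hs]

/-- On the region where `v_l · x` is smallest, the form with exponents adding up to `1`. -/
theorem exists_lintegral_regionKernel_simplex_le (hk : 1 ≤ k) (hN : 2 ≤ N)
    (hv : ∀ i j, i ≠ j → LinearIndependent ℝ ![v i, v j]) (l : Fin N) {ρ : Fin N → ℝ} {γ : ℝ}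
    (hρ0 : ∀ j, 0 ≤ ρ j) (hρ : ∑ j, ρ j = 1) (hγ : γ < k * (1 - ρ l)) :
    ∃ D : ℝ≥0, ∀ G : Fin N → Rk k → ℝ≥0∞, (∀ j, Measurable (G j)) → (∀ j, ∫⁻ y, G j y = 1) →
      ∫⁻ x in smallestRegion v l,
        regionKernel v l k γ x * ∏ j, G j (pairing (v j) x) ^ ρ j ≤ D := by
  set ε := k * (1 - ρ l) - γ with hε
  have hε0 : 0 < ε := sub_pos.2 hγ
  -- Each single-function form gets its own exponent, just inside its admissible range: e_l < 0 and
  -- e_j < k otherwise. The choice of ε makes their ρ-average equal to γ.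
  set e : Fin N → ℝ := fun j => if j = l then -ε else k - ε with he
  have hel : e l = -ε := by simp [he]
  have hesum : ∑ j, e j * ρ j = γ := by
    have : ∀ j, e j * ρ j = (k - ε) * ρ j - if j = l then k * ρ l else 0 := fun j => by
      by_cases hj : j = l
      · subst hj; simp [he]; ring
      · simp [he, hj]
    simp_rw [this]
    rw [Finset.sum_sub_distrib, ← Finset.mul_sum, hρ]
    simp [hε]
    ring
  obtain ⟨D, hD⟩ := exists_uniform_bound (ι := Fin N)
    (P := fun j c => ∀ G : Rk k → ℝ≥0∞, Measurable G → ∫⁻ y, G y = 1 →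
      ∫⁻ x in smallestRegion v l, regionKernel v l k (e j) x * G (pairing (v j) x) ≤ c)
    (fun j a b hab H G hG hG1 => (H G hG hG1).trans (by exact_mod_cast hab))
    (fun j => by
      by_cases hj : j = l
      · have : Nontrivial (Fin N) := Fin.nontrivial_iff_two_le.2 hN
        obtain ⟨m, hm⟩ := exists_ne l
        subst hj
        exact exists_lintegral_regionKernel_le_self hk (hv _ _ hm.symm) (by rw [hel]; linarith)
      · exact exists_lintegral_regionKernel_le_of_ne hk (hv _ _ hj) (by simp [he, hj, hε0]))
  refine ⟨∏ j, D ^ ρ j, fun G hG hG1 => ?_⟩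
  have hm : ∀ j, Measurable fun x => regionKernel v l k (e j) x * G j (pairing (v j) x) :=
    fun j => (measurable_regionKernel l _ _).mul ((hG j).comp (measurable_pairing _))
  calc ∫⁻ x in smallestRegion v l, regionKernel v l k γ x * ∏ j, G j (pairing (v j) x) ^ ρ j
      = ∫⁻ x in smallestRegion v l,
        ∏ j, (regionKernel v l k (e j) x * G j (pairing (v j) x)) ^ ρ j := by
        refine setLIntegral_congr_fun (measurableSet_smallestRegion l) fun x hx => ?_
        have hx0 : x ≠ 0 := by rintro rfl; exact hx.1 (by simp [pairing])
        have h1 : ‖pairing (v l) x‖ₑ ≠ 0 := by simpa using hx.1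
        have h2 : ‖x‖ₑ ≠ 0 := by simpa using hx0
        have e1 : ∑ j, -e j * ρ j = -γ := by simp only [neg_mul, Finset.sum_neg_distrib, hesum]
        have e2 : ∑ j, (e j - k) * ρ j = γ - k := by
          simp only [sub_mul, Finset.sum_sub_distrib, hesum, ← Finset.mul_sum, hρ, mul_one]
        simp only [ENNReal.mul_rpow_of_nonneg _ _ (hρ0 _), regionKernel, ← ENNReal.rpow_mul,
          Finset.prod_mul_distrib, ENNReal.prod_rpow_eq_rpow_sum _ h1 (enorm_ne_top),
          ENNReal.prod_rpow_eq_rpow_sum _ h2 (enorm_ne_top), e1, e2]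
    _ ≤ ∏ j, (∫⁻ x in smallestRegion v l,
        regionKernel v l k (e j) x * G j (pairing (v j) x)) ^ ρ j :=
        ENNReal.lintegral_prod_norm_pow_le _ (fun j _ => (hm j).aemeasurable) hρ fun j _ => hρ0 j
    _ ≤ ∏ j, (D : ℝ≥0∞) ^ ρ j := by
        gcongr with j
        · exact hρ0 j
        · exact hD j (G j) (hG j) (hG1 j)
    _ = _ := by
        push_cast
        exact Finset.prod_congr rfl fun j _ => (ENNReal.coe_rpow_of_nonneg _ (hρ0 j)).symm

/-- Splitting of exponents `θ` with sum `2 - s` as `r + (θ - r)`, where `r / s` lies in the simplex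
and `(θ - r) / (1 - s)` has coordinates in `[0, 1]`. -/
theorem exists_exponent_splitting {ι : Type*} [Fintype ι] [DecidableEq ι] (l : ι) {θ : ι → ℝ}
    {s : ℝ} (hθ0 : ∀ j, 0 < θ j) (hθ1 : ∀ j, θ j < 1) (hs0 : 0 < s) (hs1 : s ≤ 1)
    (hsum : ∑ j, θ j = 2 - s) :
    ∃ r : ι → ℝ, (∀ j, 0 ≤ r j) ∧ (∀ j, r j ≤ θ j) ∧ (∀ j, θ j - r j ≤ 1 - s) ∧
      ∑ j, r j = s ∧ r l = max 0 (θ l + s - 1) := by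
  -- The smallest value allowed by r_j ≥ 0 and θ_j - r_j ≤ 1 - s.
  set a : ι → ℝ := fun j => max 0 (θ j + s - 1) with ha
  have ha0 : ∀ j, 0 ≤ a j := fun j => le_max_left _ _
  have ha1 : ∀ j, θ j + s - 1 ≤ a j := fun j => le_max_right _ _
  have haθ : ∀ j, a j ≤ θ j := fun j => max_le (hθ0 j).le (by linarith)
  have has : ∀ j, a j ≤ s := fun j => max_le hs0.le (by linarith [hθ1 j])
  -- If two of the a_j are positive, ∑ a_j ≤ ∑ θ_j - 2(1 - s) = s; if only one is, it is at most s
  -- because θ_j < 1.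
  have hasum : ∑ j, a j ≤ s := by
    by_cases h2 : ∃ i j, i ≠ j ∧ 0 < a i ∧ 0 < a j
    · obtain ⟨i, j, hij, hi, hj⟩ := h2
      have hval : ∀ m, 0 < a m → a m = θ m - (1 - s) := fun m hm => by
        rcases max_choice 0 (θ m + s - 1) with h | h
        · exact absurd h (ne_of_gt hm)
        · rw [ha]; simp only; rw [h]; ring
      have hle : ∀ m, a m ≤ θ m - (if m = i then 1 - s else 0) - (if m = j then 1 - s else 0) := by
        intro m
        by_cases hmi : m = i
        · subst hmi; simp [hij, hval m hi]
        · by_cases hmj : m = j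
          · subst hmj; simp [hmi, hval m hj]
          · simpa [hmi, hmj] using haθ m
      have := Finset.sum_le_sum fun m (_ : m ∈ Finset.univ) => hle m
      simp only [Finset.sum_sub_distrib, Finset.sum_ite_eq', Finset.mem_univ, if_true, hsum] at this
      linarith
    · push Not at h2
      by_cases h1 : ∃ i, 0 < a i
      · obtain ⟨i, hi⟩ := h1
        rw [Finset.sum_eq_single i (fun j _ hj => le_antisymm (h2 i j hj.symm hi) (ha0 j))
          (by simp)]
        exact has i
      · push Not at h1
        exact (Finset.sum_nonpos fun j _ => h1 j).trans hs0.le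
  -- Capping r_l at a_l forces equality there. The sum of b is still at least (2 - s) + (s - 1) = 1
  -- ≥ s.
  set b := Function.update θ l (a l) with hb
  have hbl : b l = a l := by simp [hb]
  have hbj : ∀ j, j ≠ l → b j = θ j := fun j hj => by simp [hb, hj]
  have hab : ∀ j, a j ≤ b j := fun j => by
    by_cases hj : j = l
    · subst hj; exact hbl.ge
    · rw [hbj j hj]; exact haθ j
  have hbθ : ∀ j, b j ≤ θ j := fun j => by
    by_cases hj : j = l
    · subst hj; rw [hbl]; exact haθ j
    · exact (hbj j hj).le
  have hbsum : s ≤ ∑ j, b j := by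
    have h1 := Finset.add_sum_erase Finset.univ θ (Finset.mem_univ l)
    have h2 := Finset.add_sum_erase Finset.univ b (Finset.mem_univ l)
    have h3 : ∑ j ∈ Finset.univ.erase l, b j = ∑ j ∈ Finset.univ.erase l, θ j :=
      Finset.sum_congr rfl fun j hj => hbj j (Finset.ne_of_mem_erase hj)
    linarith [ha1 l]
  obtain ⟨r, h1, h2, h3⟩ := exists_sum_eq_between a b s hab hasum hbsum
  exact ⟨r, fun j => (ha0 j).trans (h1 j), fun j => (h2 j).trans (hbθ j),
    fun j => by linarith [h1 j, ha1 j], h3, le_antisymm ((h2 l).trans hbl.le) (h1 l)⟩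

/-- The form on the region where `v_l · x` is smallest, with the weight `|v_l·x|^(-γ) |x|^(γ-ks)`
for `γ < k s`. -/
theorem exists_lintegral_regionKernel_le (hk : 1 ≤ k) (hN : 2 ≤ N)
    (hv : ∀ i j, i ≠ j → LinearIndependent ℝ ![v i, v j]) (l : Fin N) {θ : Fin N → ℝ} {s γ : ℝ}
    (hθ0 : ∀ j, 0 < θ j) (hθ1 : ∀ j, θ j < 1) (hs0 : 0 < s) (hs1 : s ≤ 1)
    (hsum : ∑ j, θ j = 2 - s) (hγ : γ < k * s) (hl : θ l + γ / k < 1) :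
    ∃ D : ℝ≥0, ∀ G : Fin N → Rk k → ℝ≥0∞, (∀ j, Measurable (G j)) → (∀ j, ∫⁻ y, G j y = 1) →
      ∫⁻ x in smallestRegion v l,
        regionKernel v l (k * s) γ x * ∏ j, G j (pairing (v j) x) ^ θ j ≤ D := by
  have hk0 : (0 : ℝ) < k := by exact_mod_cast hk
  obtain ⟨r, hr0, hrθ, hrs, hrsum, hrl⟩ := exists_exponent_splitting l hθ0 hθ1 hs0 hs1 hsum
  set ρ : Fin N → ℝ := fun j => r j / s with hρ
  -- For s = 1 this is division by zero, so τ = 0; in that case θ = r and the second Hölder factor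
  -- has exponent 0.
  set τ : Fin N → ℝ := fun j => (θ j - r j) / (1 - s) with hτ
  have h1s : 0 ≤ 1 - s := by linarith
  have hρ0 : ∀ j, 0 ≤ ρ j := fun j => div_nonneg (hr0 j) hs0.le
  have hτ0 : ∀ j, 0 ≤ τ j := fun j => div_nonneg (by linarith [hrθ j]) h1s
  -- This is why r_l was taken minimal: the two branches of the maximum turn this inequality into γ
  -- < ks and θ_l + γ/k < 1.
  have hγl : γ < k * (s - r l) := by
    rw [hrl]
    rcases max_choice 0 (θ l + s - 1) with h | h
    · rw [h, sub_zero]; exact hγ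
    · rw [h]
      have : γ / k < 1 - θ l := by linarith
      rw [div_lt_iff₀ hk0] at this
      linarith
  obtain ⟨D, hD⟩ := exists_lintegral_regionKernel_simplex_le hk hN hv l (ρ := ρ) (γ := γ / s)
    hρ0 (by simp only [hρ, ← Finset.sum_div, hrsum]; exact div_self hs0.ne') (by
      rw [div_lt_iff₀ hs0]
      calc γ < k * (s - r l) := hγl
        _ = _ := by simp only [hρ]; field_simp)
  obtain ⟨D', hD'⟩ := exists_lintegral_prod_rpow_le (k := k) hv
  refine ⟨D ^ s * D' ^ (1 - s), fun G hG hG1 => ?_⟩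
  have hpow : ∀ σ : Fin N → ℝ, Measurable fun x : Rk k × Rk k => ∏ j, G j (pairing (v j) x) ^ σ j :=
    fun σ => Finset.measurable_fun_prod _ fun j _ =>
      ((hG j).comp (measurable_pairing _)).pow_const _
  calc ∫⁻ x in smallestRegion v l, regionKernel v l (k * s) γ x * ∏ j, G j (pairing (v j) x) ^ θ j
      = ∫⁻ x in smallestRegion v l,
        (regionKernel v l k (γ / s) x * ∏ j, G j (pairing (v j) x) ^ ρ j) ^ s *
          (∏ j, G j (pairing (v j) x) ^ τ j) ^ (1 - s) := by
        refine lintegral_congr fun x => ?_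
        have e1 : regionKernel v l k (γ / s) x ^ s = regionKernel v l (k * s) γ x := by
          simp only [regionKernel]
          rw [ENNReal.mul_rpow_of_nonneg _ _ hs0.le, ← ENNReal.rpow_mul, ← ENNReal.rpow_mul]
          congr 2 <;> field_simp
        rw [ENNReal.mul_rpow_of_nonneg _ _ hs0.le, e1, mul_assoc,
          ← ENNReal.prod_rpow_of_nonneg hs0.le, ← ENNReal.prod_rpow_of_nonneg h1s,
          ← Finset.prod_mul_distrib]
        congr 1
        refine Finset.prod_congr rfl fun j _ => ?_
        rw [← ENNReal.rpow_mul, ← ENNReal.rpow_mul,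
          ← ENNReal.rpow_add_of_nonneg _ _ (mul_nonneg (hρ0 j) hs0.le) (mul_nonneg (hτ0 j) h1s)]
        congr 1
        have e2 : ρ j * s = r j := div_mul_cancel₀ _ hs0.ne'
        have e3 : τ j * (1 - s) = θ j - r j := by
          rcases eq_or_ne (1 - s) 0 with h | h
          · have := hrs j
            rw [h, mul_zero]
            linarith [hrθ j]
          · exact div_mul_cancel₀ _ h
        rw [e2, e3]
        ring
    _ ≤ _ := ENNReal.lintegral_mul_norm_pow_le
        ((measurable_regionKernel l _ _).mul (hpow ρ)).aemeasurable
        (hpow τ).aemeasurable hs0.le h1s (by ring)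
    _ ≤ (D : ℝ≥0∞) ^ s * (D' : ℝ≥0∞) ^ (1 - s) := by
        gcongr ?_ ^ s * ?_
        · exact hD G hG hG1
        · rcases eq_or_ne (1 - s) 0 with h | h
          · rw [h, ENNReal.rpow_zero, ENNReal.rpow_zero]
          · refine ENNReal.rpow_le_rpow ((setLIntegral_le_lintegral _ _).trans
              (hD' G hG hG1 τ hτ0 (fun j => ?_) ?_)) h1s
            · exact div_le_one_of_le₀ (hrs j) h1s
            · simp only [hτ, ← Finset.sum_div, Finset.sum_sub_distrib, hsum, hrsum]
              rw [div_eq_iff h]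
              ring
    _ = _ := by
        push_cast
        rw [ENNReal.coe_rpow_of_nonneg _ hs0.le, ENNReal.coe_rpow_of_nonneg _ h1s]

end Region

/-! ### Summing over the regions and removing the normalization -/

section Main

variable {k N : ℕ} {v : Fin N → Fin 2 → ℝ}

/-- Where `v_l · x` is smallest, all the other `v_j · x` are comparable to `x`. -/
theorem exists_prod_weight_le (hv : ∀ i j, i ≠ j → LinearIndependent ℝ ![v i, v j]) (l : Fin N)
    (lam : Fin N → ℝ) :
    ∃ B : ℝ≥0, ∀ x ∈ (smallestRegion v l : Set (Rk k × Rk k)),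
      ∏ j, ‖pairing (v j) x‖ₑ ^ (-lam j) ≤ B * regionKernel v l (∑ j, lam j) (lam l) x := by
  have hj : ∀ j, ∃ B : ℝ≥0, j ≠ l → ∀ x ∈ (smallestRegion v l : Set (Rk k × Rk k)),
      ‖pairing (v j) x‖ₑ ^ (-lam j) ≤ B * ‖x‖ₑ ^ (-lam j) := by
    intro j
    by_cases hjl : j = l
    · exact ⟨0, fun h => (h hjl).elim⟩
    obtain ⟨C₁, h₁, hC₁⟩ := exists_enorm_pairing_le (k := k) (v j)
    obtain ⟨C₂, h₂, hC₂⟩ := exists_enorm_le_pairing (k := k) (hv l j (Ne.symm hjl))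
    -- The sign of λ_j is arbitrary, so one constant must serve both directions of the comparison
    -- with |x|.
    refine ⟨(C₁ + C₂) ^ |lam j|, fun _ x hx => ?_⟩
    have h0 : C₁ + C₂ ≠ 0 := by simp [h₁]
    rw [ENNReal.coe_rpow_of_nonneg _ (abs_nonneg _)]
    refine ENNReal.rpow_neg_le_of_comparable h0 ((hC₁ x).trans ?_) ((hC₂ x (hx.2 j)).trans ?_) _
    · gcongr; exact le_self_add
    · gcongr; exact le_add_self
  choose B hB using hj
  refine ⟨∏ j ∈ Finset.univ.erase l, B j, fun x hx => ?_⟩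
  have hx0 : x ≠ 0 := by rintro rfl; exact hx.1 (by simp [pairing])
  have h2 : ‖x‖ₑ ≠ 0 := by simpa using hx0
  rw [← Finset.mul_prod_erase _ _ (Finset.mem_univ l), regionKernel]
  calc ‖pairing (v l) x‖ₑ ^ (-lam l) * ∏ j ∈ Finset.univ.erase l, ‖pairing (v j) x‖ₑ ^ (-lam j)
      ≤ ‖pairing (v l) x‖ₑ ^ (-lam l) *
        ∏ j ∈ Finset.univ.erase l, (B j * ‖x‖ₑ ^ (-lam j)) := by
        gcongr with j hj
        exact hB j (Finset.ne_of_mem_erase hj) x hx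
    _ = _ := by
        rw [Finset.prod_mul_distrib, ENNReal.prod_rpow_eq_rpow_sum _ h2 enorm_ne_top,
          Finset.sum_neg_distrib, ← Finset.add_sum_erase _ lam (Finset.mem_univ l)]
        push_cast
        have : lam l - (lam l + ∑ j ∈ Finset.univ.erase l, lam j)
            = -∑ j ∈ Finset.univ.erase l, lam j := by ring
        rw [this]
        ring

theorem exists_lintegral_smallestRegion_le (hk : 1 ≤ k) (hN : 2 ≤ N)
    (hv : ∀ i j, i ≠ j → LinearIndependent ℝ ![v i, v j]) (l : Fin N) {θ lam : Fin N → ℝ}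
    (hθ0 : ∀ j, 0 < θ j) (hθ1 : ∀ j, θ j < 1) (hscaling : ∑ j, (θ j + lam j / k) = 2)
    (hl : θ l + lam l / k < 1) (hindex : ∀ j, lam j ≤ ∑ i, lam i) (hinterp : 1 ≤ ∑ j, θ j) :
    ∃ D : ℝ≥0, ∀ G : Fin N → Rk k → ℝ≥0∞, (∀ j, Measurable (G j)) → (∀ j, ∫⁻ y, G j y = 1) →
      ∫⁻ x in smallestRegion v l,
        ∏ j, (G j (pairing (v j) x) ^ θ j * ‖pairing (v j) x‖ₑ ^ (-lam j)) ≤ D := by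
  have hk0 : (0 : ℝ) < k := by exact_mod_cast hk
  set L := ∑ i, lam i with hL
  have hsum : ∑ j, θ j = 2 - L / k := by
    rw [Finset.sum_add_distrib, ← Finset.sum_div] at hscaling
    linarith
  -- Summing λ_j ≤ L over j gives L ≤ N L, and N ≥ 2.
  have hL0 : 0 ≤ L := by
    have h1 : L ≤ N * L := by
      simpa using Finset.sum_le_sum fun j (_ : j ∈ Finset.univ) => hindex j
    have h2 : (2 : ℝ) ≤ N := by exact_mod_cast hN
    nlinarith
  obtain ⟨B, hB⟩ := exists_prod_weight_le (k := k) hv l lam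
  have key : ∃ D : ℝ≥0, ∀ G : Fin N → Rk k → ℝ≥0∞, (∀ j, Measurable (G j)) →
      (∀ j, ∫⁻ y, G j y = 1) →
      ∫⁻ x in smallestRegion v l,
        regionKernel v l L (lam l) x * ∏ j, G j (pairing (v j) x) ^ θ j ≤ D := by
    -- A strict inequality for one index forces L > 0, so s = L/k may be used. In the case of
    -- equality the power of |x| disappears and the estimate holds on the whole space.
    rcases (hindex l).lt_or_eq with hlt | heq
    · have hLpos : 0 < L := by
        refine hL0.lt_of_ne fun h0 => ?_
        have : L < N * L := by
          simpa using Finset.sum_lt_sum (fun j (_ : j ∈ Finset.univ) => hindex j)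
            ⟨l, Finset.mem_univ l, hlt⟩
        rw [← h0] at this
        simp at this
      have hkL : k * (L / k) = L := by field_simp
      have := exists_lintegral_regionKernel_le hk hN hv l (s := L / k) (γ := lam l) hθ0 hθ1
        (div_pos hLpos hk0) (by linarith) hsum (by rwa [hkL]) hl
      rwa [hkL] at this
    · obtain ⟨D, hD⟩ := exists_lintegral_singleWeight_le hk hv l hθ0 hθ1 hL0 (by rwa [← heq]) hsum
      refine ⟨D, fun G hG hG1 => (setLIntegral_le_lintegral _ _).trans ?_⟩
      refine le_of_eq_of_le (lintegral_congr fun x => ?_) (hD G hG hG1)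
      rw [regionKernel, heq, sub_self, ENNReal.rpow_zero, mul_one]
  obtain ⟨D, hD⟩ := key
  refine ⟨B * D, fun G hG hG1 => ?_⟩
  calc ∫⁻ x in smallestRegion v l,
        ∏ j, (G j (pairing (v j) x) ^ θ j * ‖pairing (v j) x‖ₑ ^ (-lam j))
      ≤ ∫⁻ x in smallestRegion v l,
        B * (regionKernel v l L (lam l) x * ∏ j, G j (pairing (v j) x) ^ θ j) := by
        refine setLIntegral_mono' (measurableSet_smallestRegion l) fun x hx => ?_
        rw [Finset.prod_mul_distrib, mul_comm, ← mul_assoc]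
        gcongr
        exact hB x hx
    _ = B * ∫⁻ x in smallestRegion v l,
        regionKernel v l L (lam l) x * ∏ j, G j (pairing (v j) x) ^ θ j :=
        lintegral_const_mul' _ _ ENNReal.coe_ne_top
    _ ≤ B * D := by gcongr; exact hD G hG hG1
    _ = _ := by push_cast; rfl

theorem ae_exists_mem_smallestRegion (hk : 1 ≤ k) (hN : 2 ≤ N)
    (hv : ∀ i j, i ≠ j → LinearIndependent ℝ ![v i, v j]) :
    ∀ᵐ x : Rk k × Rk k, x ∈ ⋃ l, smallestRegion v l := by
  have : Nontrivial (Fin N) := Fin.nontrivial_iff_two_le.2 hN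
  have hne : ∀ᵐ x : Rk k × Rk k, ∀ j, pairing (v j) x ≠ 0 := by
    refine ae_all_iff.2 fun j => ?_
    obtain ⟨m, hm⟩ := exists_ne j
    exact (quasiMeasurePreserving_pairing (hv j m hm.symm)).ae (ae_ne_zero hk)
  filter_upwards [hne] with x hx
  obtain ⟨l, hl⟩ := Finite.exists_min fun j => ‖pairing (v j) x‖
  exact Set.mem_iUnion.2 ⟨l, hx l, hl⟩

theorem weightedNorm_eq {p a : ℝ} (hp : 0 < p) (f : Rk k → ℝ≥0∞) :
    weightedNorm p a f = (∫⁻ y, (‖y‖ₑ ^ a * f y) ^ p) ^ (1 / p) := by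
  rw [weightedNorm, eLpNorm_eq_lintegral_rpow_enorm_toReal (by simpa using hp) (by simp),
    ENNReal.toReal_ofReal hp.le]
  rfl

theorem weightedNorm_enorm {𝕜 : Type*} [NormedAddCommGroup 𝕜] {p a : ℝ} (f : Rk k → 𝕜) :
    weightedNorm p a (fun y => ‖f y‖ₑ) = weightedNorm p a f := by
  simp [weightedNorm]

/-- The bound for measurable functions with norm `1`. -/
theorem exists_formNonneg_le_of_normalized (hk : 1 ≤ k) (hN : 2 ≤ N)
    (hv : ∀ i j, i ≠ j → LinearIndependent ℝ ![v i, v j]) {p lam : Fin N → ℝ}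
    (hp : ∀ j, 1 / p j ∈ Set.Ioo (0 : ℝ) 1) (hscaling : ∑ j, (1 / p j + lam j / (k : ℝ)) = 2)
    (hl : ∀ l, 1 / p l + lam l / k < 1) (hindex : ∀ j, lam j ≤ ∑ i, lam i)
    (hinterp : 1 ≤ ∑ j, 1 / p j) :
    ∃ D : ℝ≥0, ∀ f : Fin N → Rk k → ℝ≥0∞, (∀ j, Measurable (f j)) →
      (∀ j, weightedNorm (p j) (lam j) (f j) = 1) → formNonneg v f ≤ D := by
  have hp0 : ∀ j, 0 < p j := fun j => one_div_pos.1 (hp j).1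
  have hreg := fun l => exists_lintegral_smallestRegion_le hk hN hv l (θ := fun j => 1 / p j)
    (lam := lam) (fun j => (hp j).1) (fun j => (hp j).2) hscaling (hl l) hindex hinterp
  choose D hD using hreg
  refine ⟨∑ l, D l, fun f hf hf1 => ?_⟩
  set G : Fin N → Rk k → ℝ≥0∞ := fun j y => (‖y‖ₑ ^ lam j * f j y) ^ p j with hG
  have hGm : ∀ j, Measurable (G j) := fun j =>
    ((measurable_enorm.pow_const _).mul (hf j)).pow_const _
  have hG1 : ∀ j, ∫⁻ y, G j y = 1 := fun j => by
    have := hf1 j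
    rw [weightedNorm_eq (hp0 j)] at this
    have h2 := congrArg (fun t : ℝ≥0∞ => t ^ p j) this
    -- Raising the norm identity to the power p_j removes the outer root.
    simpa [← ENNReal.rpow_mul, (hp0 j).ne'] using h2
  have hpt : ∀ x : Rk k × Rk k, (∀ j, pairing (v j) x ≠ 0) → formIntegrand v f x
      = ∏ j, (G j (pairing (v j) x) ^ (1 / p j) * ‖pairing (v j) x‖ₑ ^ (-lam j)) := by
    intro x hx
    refine Finset.prod_congr rfl fun j _ => ?_
    have h0 : ‖pairing (v j) x‖ₑ ≠ 0 := by simpa using hx j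
    simp only [hG]
    rw [← ENNReal.rpow_mul, mul_one_div_cancel (hp0 j).ne', ENNReal.rpow_one, mul_right_comm,
      ← ENNReal.rpow_add _ _ h0 enorm_ne_top, add_neg_cancel, ENNReal.rpow_zero, one_mul]
  calc formNonneg v f = ∫⁻ x in ⋃ l, smallestRegion v l, formIntegrand v f x := by
        rw [formNonneg,
          Measure.restrict_eq_self_of_ae_mem (ae_exists_mem_smallestRegion hk hN hv)]
    _ ≤ ∑' l, ∫⁻ x in smallestRegion v l, formIntegrand v f x := lintegral_iUnion_le _ _
    _ = ∑ l, ∫⁻ x in smallestRegion v l, formIntegrand v f x := tsum_fintype _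
    _ ≤ ∑ l, (D l : ℝ≥0∞) := by
        refine Finset.sum_le_sum fun l _ => ?_
        refine le_of_eq_of_le (setLIntegral_congr_fun (measurableSet_smallestRegion l)
          fun x hx => hpt x fun j h => ?_) (hD l G hGm hG1)
        have := hx.2 j
        rw [h, norm_zero] at this
        exact hx.1 (norm_le_zero_iff.1 this)
    _ = _ := by push_cast; rfl

theorem weightedNorm_const_mul {p a : ℝ} (hp : 0 < p) (c : ℝ≥0∞) (f : Rk k → ℝ≥0∞)
    (hf : Measurable f) :
    weightedNorm p a (fun y => c * f y) = c * weightedNorm p a f := by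
  rw [weightedNorm_eq hp, weightedNorm_eq hp]
  have : ∀ y : Rk k, (‖y‖ₑ ^ a * (c * f y)) ^ p = c ^ p * (‖y‖ₑ ^ a * f y) ^ p := fun y => by
    rw [← ENNReal.mul_rpow_of_nonneg _ _ hp.le]; ring_nf
  have hm : Measurable fun y : Rk k => (‖y‖ₑ ^ a * f y) ^ p :=
    ((measurable_enorm.pow_const _).mul hf).pow_const _
  simp_rw [this]
  rw [lintegral_const_mul _ hm,
    ENNReal.mul_rpow_of_nonneg _ _ (by positivity), ← ENNReal.rpow_mul, mul_one_div_cancel hp.ne',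
    ENNReal.rpow_one]

theorem ae_eq_zero_of_weightedNorm_eq_zero (hk : 1 ≤ k) {p a : ℝ} (hp : 0 < p)
    {f : Rk k → ℝ≥0∞} (hf : Measurable f) (h : weightedNorm p a f = 0) : ∀ᵐ y, f y = 0 := by
  have hm : Measurable fun y : Rk k => (‖y‖ₑ ^ a * f y) ^ p :=
    ((measurable_enorm.pow_const _).mul hf).pow_const _
  rw [weightedNorm_eq hp, ENNReal.rpow_eq_zero_iff_of_pos (by positivity),
    lintegral_eq_zero_iff hm] at h
  filter_upwards [h, ae_ne_zero hk] with y hy hy0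
  have h1 : ‖y‖ₑ ^ a * f y = 0 := by
    simpa [ENNReal.rpow_eq_zero_iff_of_pos hp] using hy
  rcases mul_eq_zero.1 h1 with h2 | h2
  · exact absurd h2 (ENNReal.rpow_pos (by simpa [pos_iff_ne_zero] using hy0) enorm_ne_top).ne'
  · exact h2

theorem exists_formNonneg_le (hk : 1 ≤ k) (hN : 2 ≤ N)
    (hv : ∀ i j, i ≠ j → LinearIndependent ℝ ![v i, v j]) {p lam : Fin N → ℝ}
    (hp : ∀ j, 1 / p j ∈ Set.Ioo (0 : ℝ) 1) (hscaling : ∑ j, (1 / p j + lam j / (k : ℝ)) = 2)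
    (hl : ∀ l, 1 / p l + lam l / k < 1) (hindex : ∀ j, lam j ≤ ∑ i, lam i)
    (hinterp : 1 ≤ ∑ j, 1 / p j) :
    ∃ C : ℝ≥0, ∀ f : Fin N → Rk k → ℝ≥0∞, (∀ j, AEMeasurable (f j) volume) →
      formNonneg v f ≤ C * ∏ j, weightedNorm (p j) (lam j) (f j) := by
  have : Nontrivial (Fin N) := Fin.nontrivial_iff_two_le.2 hN
  have hqmp : ∀ j, Measure.QuasiMeasurePreserving (pairing (v j) : Rk k × Rk k → Rk k) := fun j => by
    obtain ⟨m, hm⟩ := exists_ne j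
    exact quasiMeasurePreserving_pairing (hv j m hm.symm)
  have hp0 : ∀ j, 0 < p j := fun j => one_div_pos.1 (hp j).1
  obtain ⟨D, hD⟩ := exists_formNonneg_le_of_normalized hk hN hv hp hscaling hl hindex hinterp
  -- The form and the norms are homogeneous, so finite nonzero norms can be scaled to 1. A zero norm
  -- makes the form vanish; if a norm is infinite and none is zero, the right side is ∞, for which
  -- `D + 1` must be nonzero.
  have hmeas : ∀ f : Fin N → Rk k → ℝ≥0∞, (∀ j, Measurable (f j)) →
      formNonneg v f ≤ (D + 1 : ℝ≥0) * ∏ j, weightedNorm (p j) (lam j) (f j) := by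
    intro f hf
    by_cases h0 : ∃ j, weightedNorm (p j) (lam j) (f j) = 0
    · obtain ⟨j, hj⟩ := h0
      have hz := (hqmp j).ae (ae_eq_zero_of_weightedNorm_eq_zero hk (hp0 j) (hf j) hj)
      have : formNonneg v f = 0 := by
        rw [formNonneg, lintegral_congr_ae (g := fun _ => 0), lintegral_zero]
        filter_upwards [hz] with x hx
        exact Finset.prod_eq_zero (Finset.mem_univ j) hx
      rw [this]
      exact zero_le
    push Not at h0
    by_cases htop : ∃ j, weightedNorm (p j) (lam j) (f j) = ∞
    · obtain ⟨j, hj⟩ := htop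
      have h1 : ∏ j, weightedNorm (p j) (lam j) (f j) = ∞ := by
        rw [← Finset.mul_prod_erase _ _ (Finset.mem_univ j), hj]
        exact ENNReal.top_mul (Finset.prod_ne_zero_iff.2 fun i _ => h0 i)
      rw [h1, ENNReal.mul_top (by simp)]
      exact le_top
    push Not at htop
    set n : Fin N → ℝ≥0∞ := fun j => weightedNorm (p j) (lam j) (f j) with hn
    have hnorm := hD (fun j y => (n j)⁻¹ * f j y) (fun j => (hf j).const_mul _) fun j => by
      rw [weightedNorm_const_mul (hp0 j) _ _ (hf j)]
      exact ENNReal.inv_mul_cancel (h0 j) (htop j)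
    have hfac : formNonneg v f = (∏ j, n j) * formNonneg v fun j y => (n j)⁻¹ * f j y := by
      rw [formNonneg, formNonneg, ← lintegral_const_mul' _ _ (ENNReal.prod_ne_top fun j _ => htop j)]
      refine lintegral_congr fun x => ?_
      rw [formIntegrand, formIntegrand, ← Finset.prod_mul_distrib]
      refine Finset.prod_congr rfl fun j _ => ?_
      rw [← mul_assoc, ENNReal.mul_inv_cancel (h0 j) (htop j), one_mul]
    rw [hfac, mul_comm]
    gcongr
    exact hnorm.trans (by push_cast; exact le_self_add)
  refine ⟨D + 1, fun f hf => ?_⟩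
  -- Measurable representatives change neither side, since preimages of null sets under the pairings
  -- are null.
  have hae : ∀ j, f j =ᵐ[volume] (hf j).mk (f j) := fun j => (hf j).ae_eq_mk
  have h1 : formNonneg v f = formNonneg v fun j => (hf j).mk (f j) := by
    refine lintegral_congr_ae ?_
    filter_upwards [ae_all_iff.2 fun j => (hqmp j).ae (hae j)] with x hx
    exact Finset.prod_congr rfl fun j _ => hx j
  have h2 : ∀ j, weightedNorm (p j) (lam j) (f j)
      = weightedNorm (p j) (lam j) ((hf j).mk (f j)) := fun j => by
    refine eLpNorm_congr_ae ?_
    filter_upwards [hae j] with y hy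
    rw [hy]
  rw [h1]
  simp_rw [h2]
  exact hmeas _ fun j => (hf j).measurable_mk

end Main

theorem theorem1p2 (k N : ℕ) (hk : 1 ≤ k)
    (v : Fin N → Fin 2 → ℝ)
    (hv0 : ∀ j, v j ≠ 0)
    -- two linearly independent vectors of `ℝ²` form a basis
    (hv : ∀ i j, i ≠ j → LinearIndependent ℝ ![v i, v j])
    (p lam : Fin N → ℝ)
    (hp : ∀ j, 1 / p j ∈ Set.Ioo (0 : ℝ) 1)
    (hscaling : ∑ j, (1 / p j + lam j / (k : ℝ)) = 2)
    (hstrict : ∀ l, 1 < ∑ j ∈ Finset.univ.erase l, (1 / p j + lam j / (k : ℝ)))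
    (hindex : ∀ l, 0 ≤ ∑ j ∈ Finset.univ.erase l, lam j)
    (hinterp : 1 ≤ ∑ j, 1 / p j) :
    ∃ C : ℝ≥0,
      -- nonnegative functions: an inequality in `[0, ∞]`
      (∀ f : Fin N → Rk k → ℝ≥0∞, (∀ j, AEMeasurable (f j) volume) →
        formNonneg v f ≤ (C : ℝ≥0∞) * ∏ j, weightedNorm (p j) (lam j) (f j)) ∧
      -- real or complex functions: the integral converges absolutely and obeys the same bound
      (∀ (𝕜 : Type) [RCLike 𝕜] (f : Fin N → Rk k → 𝕜),
        (∀ j, MemWeightedLp (p j) (lam j) (f j)) →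
        Integrable (formIntegrand v f) volume ∧
        ‖form v f‖ ≤ (C : ℝ) * ∏ j, (weightedNorm (p j) (lam j) (f j)).toReal) := by
  have hl : ∀ l, 1 / p l + lam l / k < 1 := fun l => by
    have h1 := Finset.add_sum_erase Finset.univ (fun j => 1 / p j + lam j / (k : ℝ))
      (Finset.mem_univ l)
    have h2 := hstrict l
    linarith
  have hidx : ∀ l, lam l ≤ ∑ i, lam i := fun l => by
    rw [← Finset.add_sum_erase _ lam (Finset.mem_univ l)]
    linarith [hindex l]
  -- The scaling sum is 2 while each of its terms is below 1.
  have hN : 2 ≤ N := by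
    have := two_le_card_of_sum (s := Finset.univ) (fun j => (hl j).le) (by rw [hscaling]; norm_num)
    simpa using this
  obtain ⟨C, hC⟩ := exists_formNonneg_le hk hN hv hp hscaling hl hidx hinterp
  refine ⟨C, hC, fun 𝕜 _ f hf => ?_⟩
  have : Nontrivial (Fin N) := Fin.nontrivial_iff_two_le.2 hN
  have hbound := hC (fun j y => ‖f j y‖ₑ) fun j => (hf j).1.enorm
  simp only [weightedNorm_enorm] at hbound
  have henorm : ∫⁻ x, ‖formIntegrand v f x‖ₑ = formNonneg v fun j y => ‖f j y‖ₑ := by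
    refine lintegral_congr fun x => ?_
    simp only [formIntegrand, enorm_eq_nnnorm, nnnorm_prod]
    push_cast
    rfl
  have hfin : (C : ℝ≥0∞) * ∏ j, weightedNorm (p j) (lam j) (f j) ≠ ∞ :=
    ENNReal.mul_ne_top ENNReal.coe_ne_top (ENNReal.prod_ne_top fun j _ => (hf j).2.ne)
  have hmeas : AEStronglyMeasurable (formIntegrand v f) volume := by
    refine Finset.aestronglyMeasurable_fun_prod _ fun j _ => ?_
    obtain ⟨m, hm⟩ := exists_ne j
    exact (hf j).1.comp_quasiMeasurePreserving (quasiMeasurePreserving_pairing (hv j m hm.symm))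
  refine ⟨⟨hmeas, ?_⟩, ?_⟩
  · rw [HasFiniteIntegral, henorm]
    exact hbound.trans_lt hfin.lt_top
  · have h1 : ‖form v f‖ₑ ≤ C * ∏ j, weightedNorm (p j) (lam j) (f j) :=
      (enorm_integral_le_lintegral_enorm _).trans (henorm.le.trans hbound)
    have h2 := ENNReal.toReal_mono hfin h1
    simpa [ENNReal.toReal_mul, ENNReal.toReal_prod] using h2
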